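/- Let $\mathcal H_1$ be a finite-dimensional and $\mathcal H_2$ an arbitrary complex Hilbert space. For a unital $*$-algebra $\mathcal A$ of operators on a Hilbert space let $\mathcal S(\mathcal A)$ be its state space with the weak-$*$ topology, and for $\omega\in\mathcal S(\mathcal A)$ let $M_\omega(\mathcal S(\mathcal A))$ be the set of Radon probability measures $\mu$ on $\mathcal S(\mathcal A)$ with barycenter $\omega$, i.e. $\int\varphi(a)\,d\mu(\varphi)=\omega(a)$ for all $a\in\mathcal A$. For a state $\psi$ on $\mathcal B(\mathcal K)$, $\dim\mathcal K<\infty$, with density matrix $\varrho_\psi$, let $S(\psi)=-\mathrm{Tr}\,\varrho_\psi\log\varrho_\psi$ be the von Neumann entropy. For a state $\omega$ on $\mathcal A=\mathcal B(\mathcal H_1)\otimes\mathcal M$ the entanglement of formation is $$E(\omega)=\inf_{\mu\in M_\omega(\mathcal S(\mathcal A))}\int S(r\varphi)\,d\mu(\varphi),\qquad (r\varphi)(X)=\varphi(X\otimes\mathbf 1),\quad X\in\mathcal B(\mathcal H_1).$$ For a state $\Omega$ on the doubled system $\mathcal A\otimes\mathcal A$ it is defined in the same way, relative to the subsystem $\mathcal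 B(\mathcal H_1)\otimes\mathcal B(\mathcal H_1)=\mathcal B(\mathcal H_1\otimes\mathcal H_1)$: $$E(\Omega)=\inf_{\mu\in M_\Omega(\mathcal S(\mathcal A\otimes\mathcal A))}\int S(r\nu)\,d\mu(\nu),\qquad (r\nu)(X\otimes Y)=\nu\big((X\otimes\mathbf 1)\otimes(Y\otimes\mathbf 1)\big).$$ Then: (i) Let $\mathcal M\subseteq\mathcal B(\mathcal H_2)$ be a $C^*$-subalgebra containing the identity, and let $\otimes$ denote the spatial $C^*$-tensor product. For every state $\omega$ on $\mathcal A$ there is exactly one state $\omega\otimes\omega$ on $\mathcal A\otimes\mathcal A$ with $(\omega\otimes\omega)(a\otimes b)=\omega(a)\omega(b)$ for all $a,b\in\mathcal A$, and $$E(\omega\otimes\omega)\le 2E(\omega).$$ (ii) Let $\mathcal M\subseteq\mathcal B(\mathcal H_2)$ be a von Neumann algebra, and let $\otimes$ denote the von Neumann algebra tensor product. For every normal state $\omega$ on $\mathcal A$ (one given by a density matrix) there is exactly one normal state $\omega\otimes\omega$ on $\mathcal A\otimes\mathcal A$ with $(\omega\otimes\omega)(a\otimes b)=\omega(a)\omega(b)$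 for all $a,b\in\mathcal A$, and again $$E(\omega\otimes\omega)\le 2E(\omega),$$ where $\mathcal S$ still denotes the set of all (not only normal) states. -/

import Mathlib

open scoped TensorProduct ComplexOrder InnerProductSpace
open MeasureTheory

noncomputable section

/-! ### Hilbert space tensor products and tensor products of operator algebras -/

section Operators

variable {H K : Type*} [NormedAddCommGroup H] [InnerProductSpace ℂ H]
  [NormedAddCommGroup K] [InnerProductSpace ℂ K]

/-- The Hilbert space tensor product: the completion of the algebraic tensor product. -/
def HilbertTensor (H K : Type*) [NormedAddCommGroup H] [InnerProductSpace ℂ H]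
    [NormedAddCommGroup K] [InnerProductSpace ℂ K] : Type _ :=
  UniformSpace.Completion (H ⊗[ℂ] K)

instance : NormedAddCommGroup (HilbertTensor H K) :=
  inferInstanceAs (NormedAddCommGroup (UniformSpace.Completion (H ⊗[ℂ] K)))

instance : InnerProductSpace ℂ (HilbertTensor H K) :=
  inferInstanceAs (InnerProductSpace ℂ (UniformSpace.Completion (H ⊗[ℂ] K)))

instance : CompleteSpace (HilbertTensor H K) :=
  inferInstanceAs (CompleteSpace (UniformSpace.Completion (H ⊗[ℂ] K)))

/-- The inclusion of the algebraic tensor product. -/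
def toHilbertTensor (H K : Type*) [NormedAddCommGroup H] [InnerProductSpace ℂ H]
    [NormedAddCommGroup K] [InnerProductSpace ℂ K] : H ⊗[ℂ] K →ₗᵢ[ℂ] HilbertTensor H K :=
  UniformSpace.Completion.toComplₗᵢ

theorem denseRange_toHilbertTensor : DenseRange (toHilbertTensor H K) :=
  UniformSpace.Completion.denseRange_coe

/-- The operator `a ⊗ b` on the Hilbert space tensor product: the continuous extension of
`x ⊗ y ↦ a x ⊗ b y`. -/
def opTensor (a : H →L[ℂ] H) (b : K →L[ℂ] K) : HilbertTensor H K →L[ℂ] HilbertTensor H K :=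
  ((toHilbertTensor H K).toContinuousLinearMap.comp (TensorProduct.mapL a b)).extend
    (toHilbertTensor H K).toContinuousLinearMap

theorem opTensor_apply (a : H →L[ℂ] H) (b : K →L[ℂ] K) (x : H ⊗[ℂ] K) :
    opTensor a b (toHilbertTensor H K x) = toHilbertTensor H K (TensorProduct.mapL a b x) :=
  ContinuousLinearMap.extend_eq _ (e := (toHilbertTensor H K).toContinuousLinearMap)
    denseRange_toHilbertTensor (toHilbertTensor H K).isometry.isUniformInducing x

/-- Two operators on the Hilbert space tensor product agree if they agree on the algebraic one. -/
theorem hilbertTensor_ext {f g : HilbertTensor H K →L[ℂ] HilbertTensor H K}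
    (h : ∀ x : H ⊗[ℂ] K, f (toHilbertTensor H K x) = g (toHilbertTensor H K x)) : f = g :=
  DFunLike.coe_injective
    (denseRange_toHilbertTensor.equalizer f.continuous g.continuous (funext h))

/-- `(a, b) ↦ a ⊗ b` as a bilinear map. -/
def opTensorₗ (H K : Type*) [NormedAddCommGroup H] [InnerProductSpace ℂ H]
    [NormedAddCommGroup K] [InnerProductSpace ℂ K] :
    (H →L[ℂ] H) →ₗ[ℂ] (K →L[ℂ] K) →ₗ[ℂ] (HilbertTensor H K →L[ℂ] HilbertTensor H K) :=
  LinearMap.mk₂ ℂ opTensor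
    (fun a a' b => hilbertTensor_ext fun x => by
      simp [opTensor_apply, TensorProduct.mapL_add_left, -TensorProduct.mapL_apply])
    (fun c a b => hilbertTensor_ext fun x => by
      simp [opTensor_apply, TensorProduct.mapL_smul_left, -TensorProduct.mapL_apply])
    (fun a b b' => hilbertTensor_ext fun x => by
      simp [opTensor_apply, TensorProduct.mapL_add_right, -TensorProduct.mapL_apply])
    (fun c a b => hilbertTensor_ext fun x => by
      simp [opTensor_apply, TensorProduct.mapL_smul_right, -TensorProduct.mapL_apply])

variable [CompleteSpace H] [CompleteSpace K]

/-- The elementary tensors `a ⊗ b` with `a ∈ A`, `b ∈ B`. -/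
def elementaryTensors (A : StarSubalgebra ℂ (H →L[ℂ] H)) (B : StarSubalgebra ℂ (K →L[ℂ] K)) :
    Set (HilbertTensor H K →L[ℂ] HilbertTensor H K) :=
  {c | ∃ a ∈ A, ∃ b ∈ B, c = opTensor a b}

/-- The spatial C⋆-tensor product: the norm closed ⋆-algebra generated by the `a ⊗ b`. -/
def cstarTensor (A : StarSubalgebra ℂ (H →L[ℂ] H)) (B : StarSubalgebra ℂ (K →L[ℂ] K)) :
    StarSubalgebra ℂ (HilbertTensor H K →L[ℂ] HilbertTensor H K) :=
  (StarAlgebra.adjoin ℂ (elementaryTensors A B)).topologicalClosure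

/-- The von Neumann algebra tensor product: the double commutant of the `a ⊗ b`. -/
def vonNeumannTensor (A : StarSubalgebra ℂ (H →L[ℂ] H)) (B : StarSubalgebra ℂ (K →L[ℂ] K)) :
    StarSubalgebra ℂ (HilbertTensor H K →L[ℂ] HilbertTensor H K) :=
  StarSubalgebra.centralizer ℂ
    (StarSubalgebra.centralizer ℂ (elementaryTensors A B) : Set _)

theorem elementaryTensors_subset_cstarTensor (A : StarSubalgebra ℂ (H →L[ℂ] H))
    (B : StarSubalgebra ℂ (K →L[ℂ] K)) :
    elementaryTensors A B ⊆ (cstarTensor A B : Set _) :=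
  fun _ hx => StarSubalgebra.le_topologicalClosure _ (StarAlgebra.subset_adjoin ℂ _ hx)

theorem elementaryTensors_subset_vonNeumannTensor (A : StarSubalgebra ℂ (H →L[ℂ] H))
    (B : StarSubalgebra ℂ (K →L[ℂ] K)) :
    elementaryTensors A B ⊆ (vonNeumannTensor A B : Set _) := by
  intro x hx
  rw [vonNeumannTensor, SetLike.mem_coe, StarSubalgebra.mem_centralizer_iff]
  intro g hg
  have h2 : star g ∈ StarSubalgebra.centralizer ℂ (elementaryTensors A B) := star_mem hg
  rw [SetLike.mem_coe, StarSubalgebra.mem_centralizer_iff] at hg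
  rw [StarSubalgebra.mem_centralizer_iff] at h2
  exact ⟨(hg x hx).1.symm, (h2 x hx).1.symm⟩

/-- `a ⊗ b` as an element of an algebra `T` that contains all elementary tensors of `A` and `B`. -/
def tmulIn {A : StarSubalgebra ℂ (H →L[ℂ] H)} {B : StarSubalgebra ℂ (K →L[ℂ] K)}
    {T : StarSubalgebra ℂ (HilbertTensor H K →L[ℂ] HilbertTensor H K)}
    (hT : elementaryTensors A B ⊆ (T : Set _)) (a : A) (b : B) : T :=
  ⟨opTensor (a : H →L[ℂ] H) (b : K →L[ℂ] K), hT ⟨a, a.2, b, b.2, rfl⟩⟩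

/-- `(a, b) ↦ a ⊗ b` as a bilinear map `A × B → T`. -/
def tmulInₗ {A : StarSubalgebra ℂ (H →L[ℂ] H)} {B : StarSubalgebra ℂ (K →L[ℂ] K)}
    {T : StarSubalgebra ℂ (HilbertTensor H K →L[ℂ] HilbertTensor H K)}
    (hT : elementaryTensors A B ⊆ (T : Set _)) : A →ₗ[ℂ] B →ₗ[ℂ] T :=
  LinearMap.mk₂ ℂ (tmulIn hT)
    (fun _ _ _ => Subtype.ext (LinearMap.map_add₂ (opTensorₗ H K) _ _ _))
    (fun _ _ _ => Subtype.ext (LinearMap.map_smul₂ (opTensorₗ H K) _ _ _))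
    (fun a _ _ => Subtype.ext (map_add (opTensorₗ H K (a : H →L[ℂ] H)) _ _))
    (fun _ a _ => Subtype.ext (map_smul (opTensorₗ H K (a : H →L[ℂ] H)) _ _))

end Operators

/-! ### States, barycenters -/

section States

variable {L : Type*} [NormedAddCommGroup L] [InnerProductSpace ℂ L] [CompleteSpace L]

/-- The state space of a unital ⋆-algebra of operators: positive normalized continuous linear
functionals. -/
def State (T : StarSubalgebra ℂ (L →L[ℂ] L)) : Type _ :=
  {φ : WeakDual ℂ T // φ 1 = 1 ∧ ∀ a : T, 0 ≤ φ (star a * a)}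

namespace State

variable {T : StarSubalgebra ℂ (L →L[ℂ] L)}

/-- The linear functional underlying a state. -/
def toLinearMap (φ : State T) : T →ₗ[ℂ] ℂ := (φ.1 : T →L[ℂ] ℂ).toLinearMap

/-- The weak-⋆ topology. -/
instance : TopologicalSpace (State T) := TopologicalSpace.induced Subtype.val inferInstance

instance : MeasurableSpace (State T) := borel _

instance : BorelSpace (State T) := ⟨rfl⟩

/-- A state is normal if it is given by a density matrix `∑ₙ |ξ n⟩⟨ξ n|`. -/
def IsNormal (φ : State T) : Prop :=
  ∃ ξ : ℕ → L, (Summable fun n => ‖ξ n‖ ^ 2) ∧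
    ∀ a : T, HasSum (fun n => ⟪ξ n, (a : L →L[ℂ] L) (ξ n)⟫_ℂ) (φ.toLinearMap a)

/-- `M_ω(S)`: the Radon probability measures on the state space with barycenter `ω`. -/
def measuresWithBarycenter (ω : State T) : Set (Measure (State T)) :=
  {μ | IsProbabilityMeasure μ ∧ μ.Regular ∧
    ∀ a : T, ∫ φ : State T, φ.toLinearMap a ∂μ = ω.toLinearMap a}

end State

/-- `Ω` is a product state `ω₁ ⊗ ω₂`: `Ω (a ⊗ b) = ω₁ a * ω₂ b`. -/
def IsProductState {H K : Type*} [NormedAddCommGroup H] [InnerProductSpace ℂ H] [CompleteSpace H]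
    [NormedAddCommGroup K] [InnerProductSpace ℂ K] [CompleteSpace K]
    {A : StarSubalgebra ℂ (H →L[ℂ] H)} {B : StarSubalgebra ℂ (K →L[ℂ] K)}
    {T : StarSubalgebra ℂ (HilbertTensor H K →L[ℂ] HilbertTensor H K)}
    (hT : elementaryTensors A B ⊆ (T : Set _)) (ω₁ : State A) (ω₂ : State B) (Ω : State T) :
    Prop :=
  ∀ (a : A) (b : B), Ω.toLinearMap (tmulIn hT a b) = ω₁.toLinearMap a * ω₂.toLinearMap b

end States

/-! ### Von Neumann entropy in finite dimension -/

section Entropy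

variable {K : Type*} [NormedAddCommGroup K] [InnerProductSpace ℂ K] [FiniteDimensional ℂ K]

/-- The density matrix of a functional on `B(K)`: the operator `ρ` with `f X = Tr (ρ X)`,
written in an orthonormal basis. -/
def densityMatrix (f : (K →L[ℂ] K) →ₗ[ℂ] ℂ) : K →L[ℂ] K :=
  ∑ i, ∑ j, f (InnerProductSpace.rankOne ℂ (stdOrthonormalBasis ℂ K i)
      (stdOrthonormalBasis ℂ K j)) •
    InnerProductSpace.rankOne ℂ (stdOrthonormalBasis ℂ K j) (stdOrthonormalBasis ℂ K i)

/-- The von Neumann entropy `-Tr (ρ log ρ)` of the functional with density matrix `ρ`. -/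
def vonNeumannEntropy (f : (K →L[ℂ] K) →ₗ[ℂ] ℂ) : ℝ :=
  haveI : CompleteSpace K := FiniteDimensional.complete ℂ K;
  -(LinearMap.trace ℂ K (densityMatrix f * CFC.log (densityMatrix f)).toLinearMap).re

theorem trace_densityMatrix_mul (f : (K →L[ℂ] K) →ₗ[ℂ] ℂ) (X : K →L[ℂ] K) :
    LinearMap.trace ℂ K (densityMatrix f * X).toLinearMap = f X := by
  set b := stdOrthonormalBasis ℂ K with hb
  have hX : X = ∑ i, ∑ j, ⟪b i, X (b j)⟫_ℂ • InnerProductSpace.rankOne ℂ (b i) (b j) := by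
    refine ContinuousLinearMap.coe_injective (b.toBasis.ext fun k => ?_)
    simp only [OrthonormalBasis.coe_toBasis, ContinuousLinearMap.coe_coe,
      _root_.sum_apply, _root_.smul_apply,
      InnerProductSpace.rankOne_apply, b.inner_eq_ite]
    simp [b.sum_repr' (X (b k))]
  have h1 : ∀ i j, LinearMap.trace ℂ K
      (densityMatrix f * InnerProductSpace.rankOne ℂ (b i) (b j)).toLinearMap =
      f (InnerProductSpace.rankOne ℂ (b i) (b j)) := by
    intro i j
    rw [LinearMap.trace_eq_sum_inner _ b]
    have h0 : ∀ k, densityMatrix f (b k) =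
        ∑ j, f (InnerProductSpace.rankOne ℂ (b k) (b j)) • b j := by
      intro k
      rw [densityMatrix, Finset.sum_comm]
      simp [← hb, _root_.sum_apply, InnerProductSpace.rankOne_apply, b.inner_eq_ite]
    simp [InnerProductSpace.rankOne_apply, b.inner_eq_ite, inner_sum, inner_smul_right, h0,
      apply_ite]
  conv_lhs => rw [hX]
  conv_rhs => rw [hX]
  simp only [Finset.mul_sum, mul_smul_comm, map_sum, map_smul, ← h1]
  simp [ContinuousLinearMap.toLinearMap_sum, map_sum]

end Entropy

/-! ### Entanglement of formation -/

section EoF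

/-- Extends a bilinear map on `B(H) × B(K)` to a linear map on `B(H ⊗ K) = B(H) ⊗ B(K)`, for
finite dimensional `H` and `K`. -/
def liftOperators {H K V : Type*} [NormedAddCommGroup H] [InnerProductSpace ℂ H]
    [FiniteDimensional ℂ H] [NormedAddCommGroup K] [InnerProductSpace ℂ K]
    [FiniteDimensional ℂ K] [AddCommGroup V] [Module ℂ V]
    (β : (H →L[ℂ] H) →ₗ[ℂ] (K →L[ℂ] K) →ₗ[ℂ] V) : (H ⊗[ℂ] K →L[ℂ] H ⊗[ℂ] K) →ₗ[ℂ] V :=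
  TensorProduct.lift (β.compl₁₂ (LinearMap.toContinuousLinearMap (𝕜 := ℂ) (E := H) (F' := H) :
      (H →ₗ[ℂ] H) →ₗ[ℂ] (H →L[ℂ] H)) (LinearMap.toContinuousLinearMap (𝕜 := ℂ) (E := K) (F' := K) :
      (K →ₗ[ℂ] K) →ₗ[ℂ] (K →L[ℂ] K))) ∘ₗ
    (homTensorHomEquiv ℂ H K H K).symm.toLinearMap ∘ₗ
    (ContinuousLinearMap.coeLM ℂ : (H ⊗[ℂ] K →L[ℂ] H ⊗[ℂ] K) →ₗ[ℂ] (H ⊗[ℂ] K →ₗ[ℂ] H ⊗[ℂ] K))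

theorem liftOperators_mapL {H K V : Type*} [NormedAddCommGroup H] [InnerProductSpace ℂ H]
    [FiniteDimensional ℂ H] [NormedAddCommGroup K] [InnerProductSpace ℂ K]
    [FiniteDimensional ℂ K] [AddCommGroup V] [Module ℂ V]
    (β : (H →L[ℂ] H) →ₗ[ℂ] (K →L[ℂ] K) →ₗ[ℂ] V) (a : H →L[ℂ] H) (b : K →L[ℂ] K) :
    liftOperators β (TensorProduct.mapL a b) = β a b := by
  have h : (homTensorHomEquiv ℂ H K H K).symm (TensorProduct.map a.toLinearMap b.toLinearMap) =
      a.toLinearMap ⊗ₜ b.toLinearMap := by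
    rw [LinearEquiv.symm_apply_eq, homTensorHomEquiv_apply, TensorProduct.homTensorHomMap_apply]
  simp [liftOperators, h]
  rfl

/-- The entanglement of formation of a state `ω` on `T` relative to the subsystem
`ι : B(K) → T`, `dim K < ∞`: the infimum of `∫ S(r φ) dμ(φ)` over the measures with barycenter `ω`,
where `r φ = φ ∘ ι` is the restriction to the subsystem. -/
def entanglementOfFormation {K L : Type*} [NormedAddCommGroup K] [InnerProductSpace ℂ K]
    [FiniteDimensional ℂ K] [NormedAddCommGroup L] [InnerProductSpace ℂ L] [CompleteSpace L]
    {T : StarSubalgebra ℂ (L →L[ℂ] L)} (ι : (K →L[ℂ] K) →ₗ[ℂ] T) (ω : State T) : ℝ :=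
  sInf ((fun μ : Measure (State T) =>
    ∫ φ : State T, vonNeumannEntropy (φ.toLinearMap ∘ₗ ι) ∂μ) '' ω.measuresWithBarycenter)

variable {H₁ H₂ : Type*} [NormedAddCommGroup H₁] [InnerProductSpace ℂ H₁] [CompleteSpace H₁]
  [FiniteDimensional ℂ H₁] [NormedAddCommGroup H₂] [InnerProductSpace ℂ H₂] [CompleteSpace H₂]
  {M : StarSubalgebra ℂ (H₂ →L[ℂ] H₂)}
  {A : StarSubalgebra ℂ (HilbertTensor H₁ H₂ →L[ℂ] HilbertTensor H₁ H₂)}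
  {T : StarSubalgebra ℂ (HilbertTensor (HilbertTensor H₁ H₂) (HilbertTensor H₁ H₂) →L[ℂ]
    HilbertTensor (HilbertTensor H₁ H₂) (HilbertTensor H₁ H₂))}

/-- The embedding `B(H₁) → B(H₁) ⊗ M`, `X ↦ X ⊗ 1`. -/
def subsystem (hA : elementaryTensors (⊤ : StarSubalgebra ℂ (H₁ →L[ℂ] H₁)) M ⊆ (A : Set _)) :
    (H₁ →L[ℂ] H₁) →ₗ[ℂ] A :=
  (tmulInₗ hA).flip 1 ∘ₗ
    { toFun := fun X => (⟨X, StarSubalgebra.mem_top⟩ : (⊤ : StarSubalgebra ℂ (H₁ →L[ℂ] H₁)))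
      map_add' := fun _ _ => rfl
      map_smul' := fun _ _ => rfl }

/-- The embedding `B(H₁ ⊗ H₁) = B(H₁) ⊗ B(H₁) → (B(H₁) ⊗ M) ⊗ (B(H₁) ⊗ M)` of the doubled first
subsystem, `X ⊗ Y ↦ (X ⊗ 1) ⊗ (Y ⊗ 1)`. -/
def doubledSubsystem
    (hA : elementaryTensors (⊤ : StarSubalgebra ℂ (H₁ →L[ℂ] H₁)) M ⊆ (A : Set _))
    (hT : elementaryTensors A A ⊆ (T : Set _)) :
    (H₁ ⊗[ℂ] H₁ →L[ℂ] H₁ ⊗[ℂ] H₁) →ₗ[ℂ] T :=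
  liftOperators ((tmulInₗ hT).compl₁₂ (subsystem hA) (subsystem hA))

end EoF

end

set_option linter.unusedSectionVars false

noncomputable section

/-! ### Entropy of density matrices in finite dimension -/

section EntropyLemmas

variable {K : Type*} [NormedAddCommGroup K] [InnerProductSpace ℂ K] [CompleteSpace K]
  [FiniteDimensional ℂ K]

/-! The inequality would be immediate if `E` were computed from finite convex decompositions. From
`ω = ∑ pᵢ φᵢ` one gets `ω ⊗ ω = ∑ pᵢ pⱼ φᵢ ⊗ φⱼ`, the restriction of `φᵢ ⊗ φⱼ` is the product of the
restrictions, entropy is additive on products, and `∑ pᵢ pⱼ (Sᵢ + Sⱼ) = 2 ∑ pᵢ Sᵢ` because the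
weights sum to one. The work lies in reducing to this case and in making sense of the products.

Reduction (`exists_finite_decomposition`). The entropy of the restriction depends only on a density
matrix in the compact set `0 ≤ ρ ≤ 1` of a finite-dimensional space, on which it is uniformly
continuous. The state space is cut into finitely many Borel cells on which this matrix is almost
constant, and a measure is replaced on each cell by the barycenter of that cell. The density matrix
of the barycenter is an average, so it stays close to those of the cell, and the mean entropy rises
by at most `ε`.

Products in the C⋆-case. A state `ψ` of the second factor defines a slice map `id ⊗ ψ` that is
positive and takes values in the first algebra; composing with `φ` gives `φ ⊗ ψ`
(`exists_productState`). Continuous functionals are determined by elementary tensors, since their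
span is norm dense.

Products in the von Neumann case. Elementary tensors determine only normal functionals
(`vonNeumannTensor_functional_ext`, a form of the bicommutant theorem on `ℓ² ⊗ L`), so the `φᵢ` must
be normal although the infimum runs over all states. They are: `pᵢ φᵢ ≤ ω` with `ω` normal, and by a
Radon–Nikodym argument a state dominated by a multiple of a normal state is normal
(`State.IsNormal.of_dominated`). Normal states have normal products, built by tensoring the vectors
of their density matrices. -/

theorem finite_real_spectrum (a : K →L[ℂ] K) : (spectrum ℝ a).Finite := by
  have h : (spectrum ℂ a).Finite := by
    have h1 := Module.End.finite_spectrum (K := ℂ) (a : K →ₗ[ℂ] K)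
    rwa [← AlgEquiv.spectrum_eq (Module.End.toContinuousLinearMap K)] at h1
  exact h.preimage Complex.ofReal_injective.injOn

/-- A finite set is discrete, so every function qualifies, in particular `Real.log` when `0` is an
eigenvalue. This discharges the continuity side conditions of the functional calculus. -/
theorem continuousOn_real_spectrum (a : K →L[ℂ] K) (f : ℝ → ℝ) :
    ContinuousOn f (spectrum ℝ a) :=
  (finite_real_spectrum a).continuousOn f

theorem mem_real_spectrum_of_eigenvector (a : K →L[ℂ] K) {v : K} (hv : v ≠ 0) {t : ℝ}
    (h : a v = (t : ℂ) • v) : t ∈ spectrum ℝ a := by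
  rw [spectrum.mem_iff]
  intro hu
  obtain ⟨u, hu⟩ := hu
  apply hv
  have h1 : ((↑u⁻¹ : K →L[ℂ] K) * (algebraMap ℝ (K →L[ℂ] K) t - a)) v = v := by
    rw [← hu]; simp
  rw [← h1]
  simp [Algebra.algebraMap_eq_smul_one, h]

/-- Functional calculus acts on eigenvectors through the eigenvalue. -/
theorem cfc_apply_eigenvector (a : K →L[ℂ] K) (ha : IsSelfAdjoint a) (f : ℝ → ℝ) {v : K} {t : ℝ}
    (h : a v = (t : ℂ) • v) : cfc f a v = (f t : ℂ) • v := by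
  by_cases hv : v = 0
  · simp [hv]
  have ht := mem_real_spectrum_of_eigenvector a hv h
  set s := (finite_real_spectrum a).toFinset with hs
  -- On the finite spectrum `f` agrees with an interpolating polynomial, which reduces the claim to
  -- powers of `a`.
  set p := Lagrange.interpolate s id f with hp
  have hpe : ∀ x ∈ spectrum ℝ a, p.eval x = f x := fun x hx =>
    Lagrange.eval_interpolate_at_node (v := id) f (Set.injOn_id _) (by simpa [hs] using hx)
  have h1 : cfc f a = Polynomial.aeval a p := by
    rw [← cfc_polynomial p a ha]
    exact cfc_congr fun x hx => (hpe x hx).symm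
  have h2 : ∀ q : Polynomial ℝ, Polynomial.aeval a q v = ((q.eval t : ℝ) : ℂ) • v := by
    intro q
    induction q using Polynomial.induction_on' with
    | add p q hp hq =>
      simp only [map_add, _root_.add_apply, hp, hq, Polynomial.eval_add, Complex.ofReal_add,
        add_smul]
    | monomial n c =>
      have h3 : (a ^ n) v = ((t : ℂ) ^ n) • v := by
        induction n with
        | zero => simp
        | succ n ih => rw [pow_succ, mul_apply_eq_comp, h, map_smul, ih, smul_smul,
            pow_succ, mul_comm]
      simp only [Polynomial.aeval_monomial, mul_apply_eq_comp, h3,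
        Algebra.algebraMap_eq_smul_one, Polynomial.eval_monomial, Complex.ofReal_mul,
        Complex.ofReal_pow, mul_smul]
      simpa using smul_comm _ _ _
  rw [h1, h2, hpe t ht]

/-- The entropy as a function of the density matrix. -/
def densityEntropy (ρ : K →L[ℂ] K) : ℝ :=
  (LinearMap.trace ℂ K (cfc Real.negMulLog ρ).toLinearMap).re

/-- Merging the product `ρ log ρ` into one function trades the discontinuous logarithm for
`Real.negMulLog`, which is continuous at `0`; continuity of the entropy in `ρ` rests on this. -/
theorem vonNeumannEntropy_eq (f : (K →L[ℂ] K) →ₗ[ℂ] ℂ) (h : IsSelfAdjoint (densityMatrix f)) :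
    vonNeumannEntropy f = densityEntropy (densityMatrix f) := by
  have h1 : cfc Real.negMulLog (densityMatrix f) =
      -(densityMatrix f * CFC.log (densityMatrix f)) := by
    have h2 : Real.negMulLog = fun x => -(id x * Real.log x) := by
      ext x; simp [Real.negMulLog]
    rw [h2, cfc_neg, cfc_mul id Real.log _ (continuousOn_real_spectrum _ _)
      (continuousOn_real_spectrum _ _), cfc_id ℝ (densityMatrix f) h, CFC.log]
  rw [densityEntropy, h1, vonNeumannEntropy]
  simp

theorem densityEntropy_eq_sum {ι : Type*} [Fintype ι] (b : OrthonormalBasis ι ℂ K)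
    {ρ : K →L[ℂ] K} (hρ : IsSelfAdjoint ρ) (t : ι → ℝ) (h : ∀ i, ρ (b i) = (t i : ℂ) • b i) :
    densityEntropy ρ = ∑ i, Real.negMulLog (t i) := by
  rw [densityEntropy, LinearMap.trace_eq_sum_inner _ b]
  simp [cfc_apply_eigenvector ρ hρ _ (h _)]

theorem spectrum_subset_of_mem_Icc {ρ : K →L[ℂ] K} (h : ρ ∈ Set.Icc 0 1) :
    spectrum ℝ ρ ⊆ Set.Icc 0 1 := by
  intro x hx
  refine ⟨spectrum_nonneg_of_nonneg h.1 hx, ?_⟩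
  have := (cfc_le_one_iff (R := ℝ) id ρ (continuousOn_real_spectrum _ _)
    (IsSelfAdjoint.of_nonneg h.1)).1 (by rw [cfc_id ℝ ρ (IsSelfAdjoint.of_nonneg h.1)]; exact h.2)
  exact this x hx

/-- The functional calculus of a fixed continuous function is continuous in the operator as long as
the spectra stay in one compact set, here `[0, 1]`. -/
theorem continuousOn_densityEntropy :
    ContinuousOn (densityEntropy (K := K)) (Set.Icc 0 1) := by
  have h1 : ContinuousOn (cfc Real.negMulLog : (K →L[ℂ] K) → (K →L[ℂ] K)) (Set.Icc 0 1) :=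
    (continuousOn_cfc (K →L[ℂ] K) (isCompact_Icc (a := (0 : ℝ)) (b := 1)) Real.negMulLog
      Real.continuous_negMulLog.continuousOn).mono
      fun ρ h => ⟨IsSelfAdjoint.of_nonneg h.1, spectrum_subset_of_mem_Icc h⟩
  have h2 : Continuous fun X : K →L[ℂ] K => (LinearMap.trace ℂ K X.toLinearMap).re :=
    Complex.continuous_re.comp (LinearMap.continuous_of_finiteDimensional
      ((LinearMap.trace ℂ K).comp (ContinuousLinearMap.coeLM ℂ)))
  exact h2.comp_continuousOn h1

theorem densityEntropy_nonneg {ρ : K →L[ℂ] K} (h : ρ ∈ Set.Icc 0 1) : 0 ≤ densityEntropy ρ := by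
  have h1 : 0 ≤ cfc Real.negMulLog ρ := cfc_nonneg fun x hx =>
    Real.negMulLog_nonneg (spectrum_subset_of_mem_Icc h hx).1 (spectrum_subset_of_mem_Icc h hx).2
  rw [ContinuousLinearMap.nonneg_iff_isPositive] at h1
  exact (Complex.le_def.1 h1.toLinearMap.trace_nonneg).1

theorem isCompact_Icc_operators : IsCompact (Set.Icc (0 : K →L[ℂ] K) 1) := by
  have : ProperSpace (K →L[ℂ] K) := FiniteDimensional.proper ℂ _
  refine Metric.isCompact_of_isClosed_isBounded isClosed_Icc ?_
  refine (Metric.isBounded_closedBall (x := (0 : K →L[ℂ] K)) (r := 1)).subset fun ρ h => ?_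
  rw [mem_closedBall_zero_iff]
  exact (CStarAlgebra.norm_le_one_iff_of_nonneg ρ h.1).2 h.2

/-- A positive normalized functional on `B(K)`. -/
def IsStateFunctional (f : (K →L[ℂ] K) →ₗ[ℂ] ℂ) : Prop :=
  f 1 = 1 ∧ ∀ X, 0 ≤ f (star X * X)

theorem IsStateFunctional.nonneg {f : (K →L[ℂ] K) →ₗ[ℂ] ℂ} (hf : IsStateFunctional f)
    {X : K →L[ℂ] K} (hX : 0 ≤ X) : 0 ≤ f X := by
  obtain ⟨Y, rfl⟩ := CStarAlgebra.nonneg_iff_eq_star_mul_self.1 hX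
  exact hf.2 Y

theorem inner_densityMatrix (f : (K →L[ℂ] K) →ₗ[ℂ] ℂ) (v w : K) :
    ⟪v, densityMatrix f w⟫_ℂ = f (InnerProductSpace.rankOne ℂ w v) := by
  rw [← trace_densityMatrix_mul]
  have : (densityMatrix f * InnerProductSpace.rankOne ℂ w v) =
      InnerProductSpace.rankOne ℂ (densityMatrix f w) v := by
    ext x; simp [InnerProductSpace.rankOne_apply]
  rw [this, LinearMap.trace_eq_sum_inner _ (stdOrthonormalBasis ℂ K)]
  simp only [ContinuousLinearMap.coe_coe, InnerProductSpace.rankOne_apply, inner_smul_right]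
  exact (OrthonormalBasis.sum_inner_mul_inner (stdOrthonormalBasis ℂ K) v _).symm

theorem nonneg_of_inner_nonneg {L : Type*} [NormedAddCommGroup L] [InnerProductSpace ℂ L]
    {S : L →L[ℂ] L} (h : ∀ x, 0 ≤ ⟪x, S x⟫_ℂ) : 0 ≤ S := by
  rw [ContinuousLinearMap.nonneg_iff_isPositive, ContinuousLinearMap.isPositive_iff_complex]
  intro x
  obtain ⟨h1, h2⟩ := Complex.le_def.1 (h x)
  have h3 : ⟪S x, x⟫_ℂ = ⟪x, S x⟫_ℂ := by
    rw [← inner_conj_symm (S x) x]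
    exact Complex.conj_eq_iff_im.2 h2.symm
  rw [h3]
  exact ⟨Complex.ext (by simp) (by simpa using h2), by simpa using h1⟩

/-- The lower bound is positivity of `f` on `|x⟩⟨x|`. The upper bound is Cauchy–Schwarz in the form
`|x⟩⟨x| ≤ ‖x‖² 1`, to which the positive normalized `f` is applied. -/
theorem IsStateFunctional.densityMatrix_mem {f : (K →L[ℂ] K) →ₗ[ℂ] ℂ} (hf : IsStateFunctional f) :
    densityMatrix f ∈ Set.Icc 0 1 := by
  constructor
  · refine nonneg_of_inner_nonneg fun x => ?_
    rw [inner_densityMatrix]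
    exact hf.nonneg ((ContinuousLinearMap.nonneg_iff_isPositive _).2
      (InnerProductSpace.isPositive_rankOne_self x))
  · rw [← sub_nonneg]
    refine nonneg_of_inner_nonneg fun x => ?_
    have h1 : ⟪x, (1 - densityMatrix f) x⟫_ℂ =
        f (((‖x‖ : ℂ) ^ 2) • 1 - InnerProductSpace.rankOne ℂ x x) := by
      rw [map_sub, map_smul, hf.1, ← inner_densityMatrix, _root_.sub_apply, inner_sub_right]
      simp [inner_self_eq_norm_sq_to_K]
    rw [h1]
    refine hf.nonneg (nonneg_of_inner_nonneg fun w => ?_)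
    have h2 : ⟪w, (((‖x‖ : ℂ) ^ 2) • (1 : K →L[ℂ] K) - InnerProductSpace.rankOne ℂ x x) w⟫_ℂ =
        (((‖x‖ * ‖w‖) ^ 2 - ‖⟪w, x⟫_ℂ‖ ^ 2 : ℝ) : ℂ) := by
      rw [_root_.sub_apply, inner_sub_right, _root_.smul_apply, inner_smul_right,
        InnerProductSpace.rankOne_apply, inner_smul_right, ← inner_conj_symm x w,
        Complex.conj_mul', one_apply_eq_self, inner_self_eq_norm_sq_to_K]
      simp only [Complex.coe_algebraMap]
      push_cast
      ring
    rw [h2, Complex.zero_le_real, sub_nonneg]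
    have := norm_inner_le_norm (𝕜 := ℂ) w x
    gcongr
    linarith

theorem densityMatrix_trace (f : (K →L[ℂ] K) →ₗ[ℂ] ℂ) (hf : f 1 = 1) :
    LinearMap.trace ℂ K (densityMatrix f).toLinearMap = 1 := by
  rw [← hf, ← trace_densityMatrix_mul, mul_one]

theorem IsStateFunctional.vonNeumannEntropy_eq {f : (K →L[ℂ] K) →ₗ[ℂ] ℂ}
    (hf : IsStateFunctional f) : vonNeumannEntropy f = densityEntropy (densityMatrix f) :=
  _root_.vonNeumannEntropy_eq f (IsSelfAdjoint.of_nonneg hf.densityMatrix_mem.1)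

theorem IsStateFunctional.vonNeumannEntropy_nonneg {f : (K →L[ℂ] K) →ₗ[ℂ] ℂ}
    (hf : IsStateFunctional f) : 0 ≤ vonNeumannEntropy f := by
  rw [hf.vonNeumannEntropy_eq]
  exact densityEntropy_nonneg hf.densityMatrix_mem

/-- An orthonormal eigenbasis of the density matrix. -/
theorem IsStateFunctional.exists_eigenbasis {f : (K →L[ℂ] K) →ₗ[ℂ] ℂ}
    (hf : IsStateFunctional f) : ∃ (n : ℕ) (b : OrthonormalBasis (Fin n) ℂ K) (t : Fin n → ℝ),
      (∀ i, densityMatrix f (b i) = (t i : ℂ) • b i) ∧ ∑ i, t i = 1 := by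
  have hs : (densityMatrix f).toLinearMap.IsSymmetric :=
    ContinuousLinearMap.isSelfAdjoint_iff_isSymmetric.1
      (IsSelfAdjoint.of_nonneg hf.densityMatrix_mem.1)
  have he : ∀ i, densityMatrix f (hs.eigenvectorBasis rfl i) =
      (hs.eigenvalues rfl i : ℂ) • hs.eigenvectorBasis rfl i :=
    fun i => hs.apply_eigenvectorBasis rfl i
  refine ⟨_, hs.eigenvectorBasis rfl, hs.eigenvalues rfl, he, ?_⟩
  have h1 := densityMatrix_trace f hf.1
  rw [LinearMap.trace_eq_sum_inner _ (hs.eigenvectorBasis rfl)] at h1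
  simp only [ContinuousLinearMap.coe_coe, he, inner_smul_right] at h1
  simp only [inner_self_eq_norm_sq_to_K, OrthonormalBasis.norm_eq_one] at h1
  simp only [Complex.coe_algebraMap, Complex.ofReal_one, one_pow, mul_one] at h1
  exact_mod_cast h1

variable {H : Type*} [NormedAddCommGroup H] [InnerProductSpace ℂ H] [CompleteSpace H]
  [FiniteDimensional ℂ H]

/-- Matrix elements between product vectors determine an operator, and the rank one operator of two
product vectors is the tensor product of rank one operators, on which `h` is known. -/
theorem densityMatrix_tensor {f : (H →L[ℂ] H) →ₗ[ℂ] ℂ} {g : (K →L[ℂ] K) →ₗ[ℂ] ℂ}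
    {h : (H ⊗[ℂ] K →L[ℂ] H ⊗[ℂ] K) →ₗ[ℂ] ℂ}
    (hfg : ∀ a b, h (TensorProduct.mapL a b) = f a * g b) :
    densityMatrix h = TensorProduct.mapL (densityMatrix f) (densityMatrix g) := by
  refine ContinuousLinearMap.coe_injective (TensorProduct.ext' fun x y => ?_)
  rw [ContinuousLinearMap.coe_coe, ContinuousLinearMap.coe_coe,
    TensorProduct.ext_iff_inner_left]
  intro v w
  have h1 : InnerProductSpace.rankOne ℂ (x ⊗ₜ[ℂ] y) (v ⊗ₜ[ℂ] w) = TensorProduct.mapL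
      (InnerProductSpace.rankOne ℂ x v) (InnerProductSpace.rankOne ℂ y w) := by
    refine ContinuousLinearMap.coe_injective (TensorProduct.ext' fun a b => ?_)
    simp [InnerProductSpace.rankOne_apply, TensorProduct.smul_tmul', smul_smul, mul_comm]
  rw [inner_densityMatrix, h1, hfg]
  simp [inner_densityMatrix]

/-- The entropy is additive on product states. -/
theorem vonNeumannEntropy_tensor {f : (H →L[ℂ] H) →ₗ[ℂ] ℂ} {g : (K →L[ℂ] K) →ₗ[ℂ] ℂ}
    {h : (H ⊗[ℂ] K →L[ℂ] H ⊗[ℂ] K) →ₗ[ℂ] ℂ} (hf : IsStateFunctional f) (hg : IsStateFunctional g)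
    (hh : letI : CompleteSpace (H ⊗[ℂ] K) := FiniteDimensional.complete ℂ _; IsStateFunctional h)
    (hfg : ∀ a b, h (TensorProduct.mapL a b) = f a * g b) :
    vonNeumannEntropy h = vonNeumannEntropy f + vonNeumannEntropy g := by
  have : CompleteSpace (H ⊗[ℂ] K) := FiniteDimensional.complete ℂ _
  obtain ⟨n, b, t, hb, ht⟩ := hf.exists_eigenbasis
  obtain ⟨m, c, u, hc, hu⟩ := hg.exists_eigenbasis
  have h1 : ∀ i, densityMatrix h (b.tensorProduct c i) =
      ((t i.1 * u i.2 : ℝ) : ℂ) • b.tensorProduct c i := by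
    rintro ⟨i, j⟩
    rw [densityMatrix_tensor hfg]
    rw [OrthonormalBasis.tensorProduct_apply, TensorProduct.mapL_apply]
    simp only [ContinuousLinearMap.coe_coe, TensorProduct.map_tmul, hb, hc,
      TensorProduct.smul_tmul_smul, Complex.ofReal_mul]
  rw [hf.vonNeumannEntropy_eq, hg.vonNeumannEntropy_eq, hh.vonNeumannEntropy_eq,
    densityEntropy_eq_sum b (.of_nonneg hf.densityMatrix_mem.1) t hb,
    densityEntropy_eq_sum c (.of_nonneg hg.densityMatrix_mem.1) u hc,
    densityEntropy_eq_sum _ (.of_nonneg hh.densityMatrix_mem.1) _ h1, Fintype.sum_prod_type]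
  -- The product rule for `Real.negMulLog` holds for zero eigenvalues as well; each of the two
  -- resulting sums then loses one factor to `∑ t = 1` or `∑ u = 1`.
  simp only [Real.negMulLog_mul, Finset.sum_add_distrib, ← Finset.sum_mul, ← Finset.mul_sum]
  rw [hu, ht, one_mul, one_mul]

end EntropyLemmas

/-! ### States, their bounds and barycenters -/

section StateLemmas

variable {L : Type*} [NormedAddCommGroup L] [InnerProductSpace ℂ L] [CompleteSpace L]

/-- A norm closed ⋆-algebra contains the square root of its positive elements. Hence positivity on
the `star a * a` with `a ∈ T` already gives positivity on all elements of `T` that are positive as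
operators. -/
theorem StarSubalgebra.exists_star_mul_self_eq {T : StarSubalgebra ℂ (L →L[ℂ] L)}
    (hT : IsClosed (T : Set (L →L[ℂ] L))) {x : L →L[ℂ] L} (hx : x ∈ T) (h0 : 0 ≤ x) :
    ∃ c : T, x = star (c : L →L[ℂ] L) * c := by
  have hc : cfc Real.sqrt x ∈ T := cfc_mem (hs := hT) (𝕜' := ℂ) Real.sqrt hx
  refine ⟨⟨_, hc⟩, ?_⟩
  have h1 : IsSelfAdjoint (cfc Real.sqrt x) := IsSelfAdjoint.cfc
  rw [h1.star_eq, ← cfc_mul Real.sqrt Real.sqrt x]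
  conv_lhs => rw [← cfc_id ℝ x (IsSelfAdjoint.of_nonneg h0)]
  exact cfc_congr fun t ht => (Real.mul_self_sqrt (spectrum_nonneg_of_nonneg h0 ht)).symm

namespace State

variable {T : StarSubalgebra ℂ (L →L[ℂ] L)}

theorem map_one (φ : State T) : φ.toLinearMap 1 = 1 := φ.2.1

theorem nonneg_star_mul_self (φ : State T) (a : T) : 0 ≤ φ.toLinearMap (star a * a) := φ.2.2 a

theorem continuous_toLinearMap (φ : State T) : Continuous φ.toLinearMap :=
  (φ.1 : T →L[ℂ] ℂ).continuous

theorem continuous_eval (a : T) : Continuous fun φ : State T => φ.toLinearMap a :=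
  (WeakDual.eval_continuous a).comp continuous_induced_dom

theorem ext {φ ψ : State T} (h : ∀ a, φ.toLinearMap a = ψ.toLinearMap a) : φ = ψ :=
  Subtype.ext (DFunLike.ext _ _ h)

/-- Points are then closed, hence Borel, as the Dirac measures below require. -/
instance : T2Space (State T) :=
  T2Space.of_injective_continuous (f := fun (φ : State T) (a : T) => φ.toLinearMap a)
    (fun _ _ h => ext fun a => congrFun h a) (continuous_pi continuous_eval)

/-- A state from a continuous positive normalized linear functional. -/
def ofLinearMap (f : T →ₗ[ℂ] ℂ) (h1 : f 1 = 1) (hpos : ∀ a, 0 ≤ f (star a * a))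
    (hc : Continuous f) : State T :=
  ⟨(⟨f, hc⟩ : T →L[ℂ] ℂ), h1, hpos⟩

theorem map_star (φ : State T) (a : T) :
    φ.toLinearMap (star a) = (starRingEnd ℂ) (φ.toLinearMap a) := by
  have h0 := (Complex.le_def.1 (φ.nonneg_star_mul_self a)).2
  -- Polarization: reality of `φ` on `star b * b` for `b = a + 1` and `b = a + i` gives the
  -- imaginary and the real part of the claim.
  have h1 := (Complex.le_def.1 (φ.nonneg_star_mul_self (a + 1))).2
  have h2 := (Complex.le_def.1 (φ.nonneg_star_mul_self (a + Complex.I • 1))).2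
  simp only [star_add, add_mul, mul_add, star_one, star_smul, mul_one, one_mul, smul_mul_assoc,
    mul_smul_comm, map_add, map_smul, φ.map_one, Complex.star_def, Complex.conj_I, smul_eq_mul]
    at h1 h2
  simp at h0 h1 h2
  refine Complex.ext ?_ ?_
  · simp; linarith
  · simp; linarith

theorem nonneg (hT : IsClosed (T : Set (L →L[ℂ] L))) (φ : State T) {x : T}
    (hx : 0 ≤ (x : L →L[ℂ] L)) : 0 ≤ φ.toLinearMap x := by
  obtain ⟨c, hc⟩ := T.exists_star_mul_self_eq hT x.2 hx
  have : x = star c * c := Subtype.ext hc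
  rw [this]
  exact φ.nonneg_star_mul_self c

/-- The positive semidefinite form of a state. -/
@[reducible]
def preInnerCore (φ : State T) : PreInnerProductSpace.Core ℂ T where
  inner a b := φ.toLinearMap (star a * b)
  conj_inner_symm a b := by rw [← φ.map_star, star_mul, star_star]
  re_inner_nonneg a := (Complex.le_def.1 (φ.nonneg_star_mul_self a)).1
  add_left a b c := by rw [star_add, add_mul, map_add]
  smul_left a b r := by rw [star_smul, smul_mul_assoc, map_smul]; rfl

theorem norm_mul_le (φ : State T) (a b : T) : ‖φ.toLinearMap (star a * b)‖ ^ 2 ≤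
    (φ.toLinearMap (star a * a)).re * (φ.toLinearMap (star b * b)).re := by
  have h := @InnerProductSpace.Core.inner_mul_inner_self_le ℂ T _ _ _ φ.preInnerCore a b
  have h2 : ‖φ.toLinearMap (star b * a)‖ = ‖φ.toLinearMap (star a * b)‖ := by
    rw [← Complex.norm_conj, ← φ.map_star, star_mul, star_star]
  rw [sq]
  nth_rw 2 [← h2]
  exact h

/-- Cauchy–Schwarz against `1` bounds `|φ a|²` by `φ (star a * a)`, and `star a * a ≤ ‖a‖² 1`. The
bound is uniform in `φ`, which makes evaluations integrable and barycenters continuous. -/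
theorem norm_le (hT : IsClosed (T : Set (L →L[ℂ] L))) (φ : State T) (a : T) :
    ‖φ.toLinearMap a‖ ≤ ‖a‖ := by
  have h1 := φ.norm_mul_le 1 a
  have h2 : 0 ≤ φ.toLinearMap (((‖a‖ ^ 2 : ℝ) : ℂ) • 1 - star a * a) := by
    refine φ.nonneg hT ?_
    have := CStarAlgebra.star_mul_le_algebraMap_norm_sq (a := (a : L →L[ℂ] L))
    rw [← sub_nonneg, Algebra.algebraMap_eq_smul_one] at this
    change 0 ≤ ((‖a‖ ^ 2 : ℝ) : ℂ) • (1 : L →L[ℂ] L) - star (a : L →L[ℂ] L) * a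
    rwa [Complex.coe_smul]
  rw [map_sub, map_smul, φ.map_one] at h2
  have h3 := (Complex.le_def.1 h2).1
  simp only [star_one, one_mul, φ.map_one, Complex.one_re] at h1
  rw [Complex.zero_re, Complex.sub_re, smul_eq_mul, mul_one, Complex.ofReal_re] at h3
  exact (sq_le_sq₀ (norm_nonneg _) (norm_nonneg _)).1 (by linarith)

theorem integrable_eval (hT : IsClosed (T : Set (L →L[ℂ] L))) (μ : Measure (State T))
    [IsFiniteMeasure μ] (a : T) : Integrable (fun φ : State T => φ.toLinearMap a) μ :=
  Integrable.of_bound (continuous_eval a).measurable.aestronglyMeasurable ‖a‖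
    (Filter.Eventually.of_forall fun φ => φ.norm_le hT a)

/-- The barycenter of a finite measure, normalized. -/
theorem exists_barycenter (hT : IsClosed (T : Set (L →L[ℂ] L))) (μ : Measure (State T))
    [IsFiniteMeasure μ] [NeZero μ] :
    ∃ ψ : State T, ∀ a, ψ.toLinearMap a = ⨍ φ : State T, φ.toLinearMap a ∂μ := by
  have hμ : μ.real Set.univ ≠ 0 := by
    simpa [measureReal_eq_zero_iff] using NeZero.ne μ
  have hμ0 : 0 ≤ μ.real Set.univ := measureReal_nonneg
  set f : T →ₗ[ℂ] ℂ :=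
    { toFun := fun a => ⨍ φ : State T, φ.toLinearMap a ∂μ
      map_add' := fun a b => by
        simp only [average_eq, map_add]
        rw [integral_add (integrable_eval hT μ a) (integrable_eval hT μ b), smul_add]
      map_smul' := fun c a => by
        simp only [average_eq, map_smul, RingHom.id_apply]
        rw [integral_smul, smul_comm] } with hf
  have hfa : ∀ a, f a = ⨍ φ : State T, φ.toLinearMap a ∂μ := fun a => rfl
  refine ⟨ofLinearMap f ?_ ?_ ?_, fun a => rfl⟩
  · rw [hfa, average_eq]
    rw [integral_congr_ae (Filter.Eventually.of_forall fun φ : State T => φ.map_one),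
      integral_const, smul_smul, inv_mul_cancel₀ hμ, one_smul]
  · intro a
    rw [hfa, average_eq]
    have h1 : ∀ φ : State T, φ.toLinearMap (star a * a) =
        ((φ.toLinearMap (star a * a)).re : ℂ) := fun φ =>
      Complex.ext (by simp) (by simpa using (Complex.le_def.1 (φ.nonneg_star_mul_self a)).2.symm)
    rw [integral_congr_ae (Filter.Eventually.of_forall h1), integral_complex_ofReal,
      Complex.real_smul, ← Complex.ofReal_mul]
    have : 0 ≤ (μ.real Set.univ)⁻¹ * ∫ φ : State T, (φ.toLinearMap (star a * a)).re ∂μ :=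
      mul_nonneg (inv_nonneg.2 hμ0) (integral_nonneg fun φ =>
        (Complex.le_def.1 (φ.nonneg_star_mul_self a)).1)
    exact Complex.zero_le_real.2 this
  · refine AddMonoidHomClass.continuous_of_bound f 1 fun a => ?_
    rw [hfa, average_eq, norm_smul, one_mul, norm_inv, Real.norm_of_nonneg hμ0, inv_mul_le_iff₀
      (lt_of_le_of_ne hμ0 hμ.symm), mul_comm]
    exact norm_integral_le_of_norm_le_const (Filter.Eventually.of_forall fun φ => φ.norm_le hT a)

end State

end StateLemmas

/-! ### Finite decompositions and the subadditivity argument -/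

section Decomposition

/-- Such a measure sees only which of the finitely many atoms lie in a set. A set is enlarged to the
open complement of the atoms it misses, and an open set is shrunk to the finite, hence compact, set
of its atoms. -/
theorem regular_sum_smul_dirac {X ι : Type*} [TopologicalSpace X] [T1Space X] [MeasurableSpace X]
    [BorelSpace X] (s : Finset ι) (c : ι → ENNReal) (hc : ∀ i ∈ s, c i ≠ ⊤) (x : ι → X) :
    (∑ i ∈ s, c i • Measure.dirac (x i)).Regular := by
  classical
  set μ := ∑ i ∈ s, c i • Measure.dirac (x i) with hμ
  have hval : ∀ A : Set X, MeasurableSet A → μ A = ∑ i ∈ s, c i * A.indicator 1 (x i) := by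
    intro A hA
    simp [hμ, Measure.finsetSum_apply, Measure.dirac_apply' _ hA]
  have hfin : IsFiniteMeasure μ := by
    refine ⟨?_⟩
    rw [hval _ .univ]
    exact ENNReal.sum_lt_top.2 fun i hi => by simpa using (hc i hi).lt_top
  have hcongr : ∀ A B : Set X, MeasurableSet A → MeasurableSet B →
      (∀ i ∈ s, x i ∈ A ↔ x i ∈ B) → μ A = μ B := by
    intro A B hA hB h
    rw [hval A hA, hval B hB]
    refine Finset.sum_congr rfl fun i hi => ?_
    by_cases h1 : x i ∈ A
    · simp [h1, (h i hi).1 h1]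
    · have h2 : x i ∉ B := fun h2 => h1 ((h i hi).2 h2)
      simp [h1, h2]
  refine
    { toIsFiniteMeasureOnCompacts := inferInstance
      toOuterRegular := ⟨?_⟩
      innerRegular := ?_ }
  · intro A hA r hr
    set F : Set X := (x '' s) \ A with hF
    have hFf : F.Finite := (s.finite_toSet.image x).subset Set.sdiff_subset
    refine ⟨Fᶜ, fun y hy hy' => hy'.2 hy, hFf.isClosed.isOpen_compl, ?_⟩
    rw [hcongr Fᶜ A hFf.isClosed.measurableSet.compl hA fun i hi => ?_]
    · exact hr
    · simp only [hF, Set.mem_compl_iff, Set.mem_sdiff, not_and, not_not]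
      exact ⟨fun h => h ⟨i, hi, rfl⟩, fun h _ => h⟩
  · intro U hU r hr
    set F : Set X := (x '' s) ∩ U with hF
    have hFf : F.Finite := (s.finite_toSet.image x).subset Set.inter_subset_left
    refine ⟨F, Set.inter_subset_right, hFf.isCompact, ?_⟩
    rw [hcongr F U hFf.isClosed.measurableSet hU.measurableSet fun i hi =>
      ⟨fun h => h.2, fun h => ⟨⟨i, hi, rfl⟩, h⟩⟩]
    exact hr

theorem integral_sum_smul_dirac {X ι E : Type*} [MeasurableSpace X] [MeasurableSingletonClass X]
    [NormedAddCommGroup E] [NormedSpace ℝ E] [CompleteSpace E]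
    (s : Finset ι) (p : ι → ℝ) (hp : ∀ i ∈ s, 0 ≤ p i) (x : ι → X) (f : X → E) :
    ∫ y, f y ∂(∑ i ∈ s, ENNReal.ofReal (p i) • Measure.dirac (x i)) = ∑ i ∈ s, p i • f (x i) := by
  rw [integral_finsetSum_measure fun i _ =>
    (integrable_dirac (by simp)).smul_measure ENNReal.ofReal_ne_top]
  refine Finset.sum_congr rfl fun i hi => ?_
  rw [integral_smul_measure, integral_dirac, ENNReal.toReal_ofReal (hp i hi)]

variable {L : Type*} [NormedAddCommGroup L] [InnerProductSpace ℂ L] [CompleteSpace L]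
  {T : StarSubalgebra ℂ (L →L[ℂ] L)}

theorem State.sum_eq_one {ι : Type*} {ω : State T} {s : Finset ι} {p : ι → ℝ} {φ : ι → State T}
    (h : ∀ a, ω.toLinearMap a = ∑ i ∈ s, (p i : ℂ) * (φ i).toLinearMap a) : ∑ i ∈ s, p i = 1 := by
  have h1 := h 1
  simp only [State.map_one, mul_one] at h1
  exact_mod_cast h1.symm

theorem State.sum_dirac_mem {ι : Type*} {ω : State T} {s : Finset ι} {p : ι → ℝ}
    {φ : ι → State T} (hp : ∀ i ∈ s, 0 ≤ p i)
    (h : ∀ a, ω.toLinearMap a = ∑ i ∈ s, (p i : ℂ) * (φ i).toLinearMap a) :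
    ∑ i ∈ s, ENNReal.ofReal (p i) • Measure.dirac (φ i) ∈ ω.measuresWithBarycenter := by
  refine ⟨⟨?_⟩, regular_sum_smul_dirac s _ (fun _ _ => ENNReal.ofReal_ne_top) φ, fun a => ?_⟩
  · simp only [Measure.finsetSum_apply, Measure.smul_apply, measure_univ, smul_eq_mul, mul_one]
    rw [← ENNReal.ofReal_sum_of_nonneg hp, State.sum_eq_one h, ENNReal.ofReal_one]
  · rw [integral_sum_smul_dirac s p hp, h a]
    simp [Complex.real_smul]

variable {K : Type*} [NormedAddCommGroup K] [InnerProductSpace ℂ K] [CompleteSpace K]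
  [FiniteDimensional ℂ K]

/-- A finite decomposition is a finitely supported measure with barycenter `ω`. Nonnegativity of the
entropy supplies the lower bound without which the real infimum would carry no information. -/
theorem entanglementOfFormation_le_sum {κ : (K →L[ℂ] K) →ₗ[ℂ] T}
    (hκ : ∀ φ : State T, IsStateFunctional (φ.toLinearMap ∘ₗ κ)) {ι : Type*} {ω : State T}
    {s : Finset ι} {p : ι → ℝ} {φ : ι → State T} (hp : ∀ i ∈ s, 0 ≤ p i)
    (h : ∀ a, ω.toLinearMap a = ∑ i ∈ s, (p i : ℂ) * (φ i).toLinearMap a) :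
    entanglementOfFormation κ ω ≤ ∑ i ∈ s, p i * vonNeumannEntropy ((φ i).toLinearMap ∘ₗ κ) := by
  refine csInf_le ⟨0, ?_⟩ ⟨_, State.sum_dirac_mem hp h, ?_⟩
  · rintro _ ⟨μ, -, rfl⟩
    exact integral_nonneg fun φ => (hκ φ).vonNeumannEntropy_nonneg
  · exact integral_sum_smul_dirac s p hp φ fun ψ => vonNeumannEntropy (ψ.toLinearMap ∘ₗ κ)

theorem continuous_densityMatrix_comp (κ : (K →L[ℂ] K) →ₗ[ℂ] T) :
    Continuous fun φ : State T => densityMatrix (φ.toLinearMap ∘ₗ κ) := by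
  refine continuous_finsetSum _ fun i _ => continuous_finsetSum _ fun j _ => ?_
  exact (State.continuous_eval _).smul continuous_const

theorem continuous_vonNeumannEntropy_comp {κ : (K →L[ℂ] K) →ₗ[ℂ] T}
    (hκ : ∀ φ : State T, IsStateFunctional (φ.toLinearMap ∘ₗ κ)) :
    Continuous fun φ : State T => vonNeumannEntropy (φ.toLinearMap ∘ₗ κ) := by
  simp_rw [fun φ => (hκ φ).vonNeumannEntropy_eq]
  exact continuousOn_densityEntropy.comp_continuous (continuous_densityMatrix_comp κ)
    fun φ => (hκ φ).densityMatrix_mem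

theorem densityMatrix_comp_barycenter (hT : IsClosed (T : Set (L →L[ℂ] L)))
    (κ : (K →L[ℂ] K) →ₗ[ℂ] T) (μ : Measure (State T)) [IsFiniteMeasure μ] {ψ : State T}
    (hψ : ∀ a, ψ.toLinearMap a = ⨍ φ : State T, φ.toLinearMap a ∂μ) :
    densityMatrix (ψ.toLinearMap ∘ₗ κ) =
      ⨍ φ : State T, densityMatrix (φ.toLinearMap ∘ₗ κ) ∂μ := by
  have hi : ∀ X (Y : K →L[ℂ] K),
      Integrable (fun φ : State T => (φ.toLinearMap ∘ₗ κ) X • Y) μ :=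
    fun X Y => (State.integrable_eval hT μ (κ X)).smul_const Y
  simp only [densityMatrix]
  rw [average_eq, integral_finsetSum _ fun i _ => integrable_finsetSum _ fun j _ => hi _ _,
    Finset.smul_sum]
  refine Finset.sum_congr rfl fun i _ => ?_
  rw [integral_finsetSum _ fun j _ => hi _ _, Finset.smul_sum]
  refine Finset.sum_congr rfl fun j _ => ?_
  rw [integral_smul_const, ← smul_assoc, LinearMap.comp_apply, hψ, average_eq]
  rfl

/-- The entropy is uniformly continuous along the restriction to the subsystem: there is a finite
measurable partition such that the entropy varies little between a state of a cell and the
barycenter of any part of that cell. -/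
theorem exists_entropy_partition {κ : (K →L[ℂ] K) →ₗ[ℂ] T} (hT : IsClosed (T : Set (L →L[ℂ] L)))
    (hκ : ∀ φ : State T, IsStateFunctional (φ.toLinearMap ∘ₗ κ)) {ε : ℝ} (hε : 0 < ε) :
    ∃ (N : ℕ) (k : State T → ℕ), Measurable k ∧ (∀ φ, k φ ≤ N) ∧
      ∀ (n : ℕ) (μ : Measure (State T)) [IsFiniteMeasure μ], μ (k ⁻¹' {n}) ≠ 0 →
        ∀ ψ : State T, (∀ a, ψ.toLinearMap a = ⨍ φ in k ⁻¹' {n}, φ.toLinearMap a ∂μ) →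
        ∀ φ : State T, k φ = n → vonNeumannEntropy (ψ.toLinearMap ∘ₗ κ) ≤
          vonNeumannEntropy (φ.toLinearMap ∘ₗ κ) + ε := by
  have : ProperSpace (K →L[ℂ] K) := FiniteDimensional.proper ℂ _
  set D : State T → (K →L[ℂ] K) := fun φ => densityMatrix (φ.toLinearMap ∘ₗ κ) with hD
  have hDm : ∀ φ, D φ ∈ Set.Icc 0 1 := fun φ => (hκ φ).densityMatrix_mem
  have hDc : Continuous D := continuous_densityMatrix_comp κ
  obtain ⟨δ, hδ, hδε⟩ := Metric.uniformContinuousOn_iff.1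
    (isCompact_Icc_operators.uniformContinuousOn_of_continuous
      (continuousOn_densityEntropy (K := K))) ε hε
  set e := TopologicalSpace.denseSeq (K →L[ℂ] K) with he
  obtain ⟨t, ht⟩ := (isCompact_Icc_operators (K := K)).elim_finite_subcover
    (fun n => Metric.ball (e n) (δ / 2)) (fun _ => Metric.isOpen_ball) fun x _ => by
      obtain ⟨y, hy, n, rfl⟩ := Metric.dense_iff.1
        (TopologicalSpace.denseRange_denseSeq (K →L[ℂ] K)) x (δ / 2) (half_pos hδ)
      exact Set.mem_iUnion.2 ⟨n, by rwa [Metric.mem_ball, dist_comm]⟩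
  -- The nearest of `e 0, …, e N` is at least as close as the centre of a covering ball, whose index
  -- is at most `N`. Cells are formed by the index of this nearest point, which depends measurably
  -- on the density matrix.
  set N := t.sup id with hN
  have hclose : ∀ x ∈ Set.Icc (0 : K →L[ℂ] K) 1,
      dist x (e (SimpleFunc.nearestPtInd e N x)) < δ / 2 := by
    intro x hx
    obtain ⟨n, hn, hxn⟩ := Set.mem_iUnion₂.1 (ht hx)
    have h1 := SimpleFunc.edist_nearestPt_le e x (k := n) (N := N) (Finset.le_sup (f := id) hn)
    rw [edist_dist, edist_dist, ENNReal.ofReal_le_ofReal_iff dist_nonneg] at h1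
    rw [dist_comm]
    exact h1.trans_lt (by rwa [dist_comm])
  refine ⟨N, fun φ => SimpleFunc.nearestPtInd e N (D φ),
    (SimpleFunc.measurable _).comp hDc.measurable, fun φ => SimpleFunc.nearestPtInd_le _ _ _, ?_⟩
  intro n μ _ hμ ψ hψ φ hφ
  set B := (fun φ => SimpleFunc.nearestPtInd e N (D φ)) ⁻¹' {n} with hB
  have hBm : MeasurableSet B :=
    ((SimpleFunc.measurable _).comp hDc.measurable) (measurableSet_singleton n)
  -- The density matrix of the barycenter is the mean of matrices in a closed convex ball. Together
  -- with `hclose` this puts `D ψ` and `D φ` at distance less than `δ`.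
  have h1 : D ψ ∈ Metric.closedBall (e n) (δ / 2) := by
    rw [hD]
    simp only
    rw [densityMatrix_comp_barycenter hT κ (μ.restrict B) hψ]
    refine (convex_closedBall _ _).set_average_mem Metric.isClosed_closedBall hμ
      (measure_ne_top _ _) ?_ ?_
    · filter_upwards [ae_restrict_mem hBm] with φ hφ
      have := hclose (D φ) (hDm φ)
      rw [show SimpleFunc.nearestPtInd e N (D φ) = n from hφ] at this
      exact Metric.mem_closedBall.2 this.le
    · refine Integrable.of_bound hDc.aestronglyMeasurable 1
        (Filter.Eventually.of_forall fun φ => ?_)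
      exact (CStarAlgebra.norm_le_one_iff_of_nonneg _ (hDm φ).1).2 (hDm φ).2
  have h2 := hclose (D φ) (hDm φ)
  rw [show SimpleFunc.nearestPtInd e N (D φ) = n from hφ] at h2
  have h3 := hδε (D ψ) (hDm ψ) (D φ) (hDm φ) (by
    have := dist_triangle_right (D ψ) (D φ) (e n)
    have := Metric.mem_closedBall.1 h1
    linarith)
  rw [(hκ ψ).vonNeumannEntropy_eq, (hκ φ).vonNeumannEntropy_eq]
  have := (abs_lt.1 (Real.dist_eq _ _ ▸ h3)).2
  linarith

/-- Every barycentric decomposition can be replaced by a finite one at small cost in the mean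
entropy. -/
theorem exists_finite_decomposition {κ : (K →L[ℂ] K) →ₗ[ℂ] T}
    (hT : IsClosed (T : Set (L →L[ℂ] L)))
    (hκ : ∀ φ : State T, IsStateFunctional (φ.toLinearMap ∘ₗ κ)) {ω : State T}
    {μ : Measure (State T)} (hμ : μ ∈ ω.measuresWithBarycenter) {ε : ℝ} (hε : 0 < ε) :
    ∃ (s : Finset ℕ) (p : ℕ → ℝ) (φ : ℕ → State T), (∀ i ∈ s, 0 < p i) ∧
      (∀ a, ω.toLinearMap a = ∑ i ∈ s, (p i : ℂ) * (φ i).toLinearMap a) ∧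
      ∑ i ∈ s, p i * vonNeumannEntropy ((φ i).toLinearMap ∘ₗ κ) ≤
        ∫ φ : State T, vonNeumannEntropy (φ.toLinearMap ∘ₗ κ) ∂μ + ε := by
  classical
  obtain ⟨hprob, -, hbar⟩ := hμ
  obtain ⟨N, k, hk, hkN, hS⟩ := exists_entropy_partition hT hκ hε
  set B : ℕ → Set (State T) := fun n => k ⁻¹' {n} with hB
  have hBm : ∀ n, MeasurableSet (B n) := fun n => hk (measurableSet_singleton n)
  -- Null cells are dropped: they carry no barycenter and contribute nothing to integrals.
  set s : Finset ℕ := (Finset.range (N + 1)).filter fun n => μ (B n) ≠ 0 with hs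
  have hsplit : ∀ {E : Type} [NormedAddCommGroup E] [NormedSpace ℝ E] (f : State T → E),
      Integrable f μ → ∫ φ, f φ ∂μ = ∑ n ∈ s, ∫ φ in B n, f φ ∂μ := by
    intro E _ _ f hf
    have h1 : (⋃ n ∈ Finset.range (N + 1), B n) = Set.univ := by
      refine Set.eq_univ_of_forall fun φ => ?_
      exact Set.mem_iUnion₂.2 ⟨k φ, Finset.mem_range.2 (Nat.lt_succ_of_le (hkN φ)), rfl⟩
    rw [← setIntegral_univ, ← h1, integral_biUnion_finset _ (fun n _ => hBm n) ?_
      fun n _ => hf.integrableOn, hs, Finset.sum_filter]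
    · refine Finset.sum_congr rfl fun n _ => ?_
      by_cases h : μ (B n) = 0
      · simp [h, Measure.restrict_eq_zero.2 h]
      · simp [h]
    · intro i _ j _ hij
      exact Set.disjoint_left.2 fun φ (h1 : k φ = i) (h2 : k φ = j) => hij (h1 ▸ h2)
  have hψ : ∀ n, ∃ ψ : State T, μ (B n) ≠ 0 →
      ∀ a, ψ.toLinearMap a = ⨍ φ in B n, φ.toLinearMap a ∂μ := by
    intro n
    by_cases h : μ (B n) = 0
    -- `ω` is a dummy value on null cells.
    · exact ⟨ω, fun h' => absurd h h'⟩
    · have : NeZero (μ.restrict (B n)) := ⟨by rwa [Ne, Measure.restrict_eq_zero]⟩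
      obtain ⟨ψ, hψ⟩ := State.exists_barycenter hT (μ.restrict (B n))
      exact ⟨ψ, fun _ => hψ⟩
  choose ψ hψ using hψ
  have hsm : ∀ n ∈ s, μ (B n) ≠ 0 := fun n hn => (Finset.mem_filter.1 hn).2
  have hp : ∀ n ∈ s, 0 < μ.real (B n) := fun n hn => by
    rw [measureReal_def]
    exact ENNReal.toReal_pos (hsm n hn) (measure_ne_top _ _)
  refine ⟨s, fun n => μ.real (B n), ψ, hp, fun a => ?_, ?_⟩
  · rw [← hbar a, hsplit _ (State.integrable_eval hT μ a)]
    refine Finset.sum_congr rfl fun n hn => ?_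
    rw [hψ n (hsm n hn) a, average_eq, measureReal_restrict_apply_univ, ← Complex.real_smul,
      smul_smul, mul_inv_cancel₀ (hp n hn).ne', one_smul]
  · have hSi : Integrable (fun φ : State T => vonNeumannEntropy (φ.toLinearMap ∘ₗ κ)) μ := by
      obtain ⟨C, hC⟩ := (isCompact_Icc_operators (K := K)).exists_bound_of_continuousOn
        continuousOn_densityEntropy
      refine Integrable.of_bound (continuous_vonNeumannEntropy_comp hκ).aestronglyMeasurable C
        (Filter.Eventually.of_forall fun φ => ?_)
      rw [(hκ φ).vonNeumannEntropy_eq]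
      exact hC _ (hκ φ).densityMatrix_mem
    have h1 : ∑ i ∈ s, μ.real (B i) = 1 := by
      have := hsplit (fun _ => (1 : ℝ)) (integrable_const _)
      simpa using this.symm
    have h2 : ∀ n ∈ s, μ.real (B n) * vonNeumannEntropy ((ψ n).toLinearMap ∘ₗ κ) ≤
        (∫ φ in B n, vonNeumannEntropy (φ.toLinearMap ∘ₗ κ) ∂μ) + μ.real (B n) * ε := by
      intro n hn
      have h3 : ∫ _ in B n, vonNeumannEntropy ((ψ n).toLinearMap ∘ₗ κ) ∂μ ≤
          ∫ φ in B n, (vonNeumannEntropy (φ.toLinearMap ∘ₗ κ) + ε) ∂μ :=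
        setIntegral_mono_on (integrable_const _) (hSi.integrableOn.add (integrable_const _))
          (hBm n) fun φ hφ => hS n μ (hsm n hn) (ψ n) (hψ n (hsm n hn)) φ hφ
      rw [integral_add hSi.integrableOn (integrable_const _)] at h3
      simpa using h3
    refine (Finset.sum_le_sum h2).trans ?_
    rw [Finset.sum_add_distrib, ← hsplit _ hSi, ← Finset.sum_mul, h1, one_mul]

/-- Subadditivity of the entanglement of formation, given compatible product decompositions. -/
theorem entanglementOfFormation_le_two_mul
    {L₂ : Type*} [NormedAddCommGroup L₂] [InnerProductSpace ℂ L₂] [CompleteSpace L₂]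
    {T₂ : StarSubalgebra ℂ (L₂ →L[ℂ] L₂)} {κ : (K →L[ℂ] K) →ₗ[ℂ] T}
    {κ₂ : (K ⊗[ℂ] K →L[ℂ] K ⊗[ℂ] K) →ₗ[ℂ] T₂} (hT : IsClosed (T : Set (L →L[ℂ] L)))
    (hκ : ∀ φ : State T, IsStateFunctional (φ.toLinearMap ∘ₗ κ))
    (hκ₂ : letI : CompleteSpace (K ⊗[ℂ] K) := FiniteDimensional.complete ℂ _
      ∀ φ : State T₂, IsStateFunctional (φ.toLinearMap ∘ₗ κ₂)) {ω : State T} {Ω : State T₂}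
    (h : ∀ (s : Finset ℕ) (p : ℕ → ℝ) (φ : ℕ → State T), (∀ i ∈ s, 0 < p i) →
      (∀ a, ω.toLinearMap a = ∑ i ∈ s, (p i : ℂ) * (φ i).toLinearMap a) →
      ∃ Φ : ℕ → ℕ → State T₂,
        (∀ i ∈ s, ∀ j ∈ s, ∀ X Y, (Φ i j).toLinearMap (κ₂ (TensorProduct.mapL X Y)) =
          (φ i).toLinearMap (κ X) * (φ j).toLinearMap (κ Y)) ∧
        ∀ x, Ω.toLinearMap x =
          ∑ i ∈ s, ∑ j ∈ s, ((p i : ℂ) * p j) * (Φ i j).toLinearMap x) :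
    entanglementOfFormation κ₂ Ω ≤ 2 * entanglementOfFormation κ ω := by
  have : CompleteSpace (K ⊗[ℂ] K) := FiniteDimensional.complete ℂ _
  suffices h' : entanglementOfFormation κ₂ Ω / 2 ≤ entanglementOfFormation κ ω by linarith
  refine le_csInf ?_ ?_
  -- The Dirac measure at `ω` shows that the infimum is over a nonempty set.
  · exact Set.Nonempty.image _ ⟨_, State.sum_dirac_mem (s := {0}) (p := fun _ : ℕ => 1)
      (φ := fun _ => ω) (by simp) (by simp)⟩
  rintro _ ⟨μ, hμ, rfl⟩
  refine le_of_forall_pos_le_add fun ε hε => ?_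
  obtain ⟨s, p, φ, hp, hω, hS⟩ := exists_finite_decomposition hT hκ hμ hε
  obtain ⟨Φ, hΦ, hΩ⟩ := h s p φ hp hω
  have h1 := entanglementOfFormation_le_sum hκ₂ (ω := Ω) (s := s ×ˢ s)
    (p := fun x => p x.1 * p x.2) (φ := fun x => Φ x.1 x.2)
    (fun x hx => (mul_pos (hp _ (Finset.mem_product.1 hx).1) (hp _ (Finset.mem_product.1 hx).2)).le)
    (fun a => by rw [hΩ a, Finset.sum_product]; simp)
  have hp1 : ∑ i ∈ s, p i = 1 := State.sum_eq_one hω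
  have h2 : ∑ x ∈ s ×ˢ s, p x.1 * p x.2 * vonNeumannEntropy ((Φ x.1 x.2).toLinearMap ∘ₗ κ₂) =
      2 * ∑ i ∈ s, p i * vonNeumannEntropy ((φ i).toLinearMap ∘ₗ κ) := by
    -- Each summand splits into two, and in each of them one index occurs only in a weight, so that
    -- it sums to one.
    have h3 : ∀ i ∈ s, ∀ j ∈ s,
        p i * p j * vonNeumannEntropy ((Φ i j).toLinearMap ∘ₗ κ₂) =
        p j * (p i * vonNeumannEntropy ((φ i).toLinearMap ∘ₗ κ)) +
        p i * (p j * vonNeumannEntropy ((φ j).toLinearMap ∘ₗ κ)) := by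
      intro i hi j hj
      rw [vonNeumannEntropy_tensor (hκ (φ i)) (hκ (φ j)) (hκ₂ (Φ i j))
        fun X Y => hΦ i hi j hj X Y]
      ring
    rw [Finset.sum_product, Finset.sum_congr rfl fun i hi => Finset.sum_congr rfl (h3 i hi)]
    simp only [Finset.sum_add_distrib, ← Finset.sum_mul, ← Finset.mul_sum]
    rw [hp1]
    ring
  linarith

end Decomposition

theorem zero_le_inner_self {L : Type*} [NormedAddCommGroup L] [InnerProductSpace ℂ L] (x : L) :
    0 ≤ ⟪x, x⟫_ℂ :=
  Complex.le_def.2 ⟨inner_self_nonneg (𝕜 := ℂ), (inner_self_im (𝕜 := ℂ) x).symm⟩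

/-! ### Elementary tensors, slice maps and product states on the spatial tensor product -/

section OperatorTensor

variable {H K : Type*} [NormedAddCommGroup H] [InnerProductSpace ℂ H]
  [NormedAddCommGroup K] [InnerProductSpace ℂ K]

/-- The continuous linear map `y ↦ x ⊗ y` into the Hilbert space tensor product. -/
def tmulLeft (x : H) : K →L[ℂ] HilbertTensor H K :=
  (toHilbertTensor H K).toContinuousLinearMap ∘L TensorProduct.mkL ℂ H K x

theorem tmulLeft_apply (x : H) (y : K) : tmulLeft x y = toHilbertTensor H K (x ⊗ₜ y) := rfl

theorem tmulLeft_add (x x' : H) :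
    (tmulLeft (x + x') : K →L[ℂ] HilbertTensor H K) = tmulLeft x + tmulLeft x' := by
  simp [tmulLeft]

theorem tmulLeft_smul (c : ℂ) (x : H) :
    (tmulLeft (c • x) : K →L[ℂ] HilbertTensor H K) = c • tmulLeft x := by
  simp [tmulLeft]

theorem norm_tmulLeft_apply (x : H) (y : K) : ‖tmulLeft x y‖ = ‖x‖ * ‖y‖ := by
  rw [tmulLeft_apply, LinearIsometry.norm_map, TensorProduct.norm_tmul]

theorem norm_tmulLeft_le (x : H) : ‖(tmulLeft x : K →L[ℂ] HilbertTensor H K)‖ ≤ ‖x‖ :=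
  ContinuousLinearMap.opNorm_le_bound _ (norm_nonneg _) fun y => (norm_tmulLeft_apply x y).le

theorem inner_tmulLeft (x x' : H) (y y' : K) :
    ⟪tmulLeft x y, tmulLeft x' y'⟫_ℂ = ⟪x, x'⟫_ℂ * ⟪y, y'⟫_ℂ := by
  rw [tmulLeft_apply, tmulLeft_apply, LinearIsometry.inner_map_map, TensorProduct.inner_tmul]

theorem tmulLeft_ext {E : Type*} [NormedAddCommGroup E] [NormedSpace ℂ E]
    {f g : HilbertTensor H K →L[ℂ] E} (h : ∀ x y, f (tmulLeft x y) = g (tmulLeft x y)) : f = g := by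
  have h1 : f.toLinearMap ∘ₗ (toHilbertTensor H K).toLinearMap =
      g.toLinearMap ∘ₗ (toHilbertTensor H K).toLinearMap := TensorProduct.ext' h
  exact DFunLike.coe_injective (denseRange_toHilbertTensor.equalizer f.continuous g.continuous
    (funext fun x => LinearMap.congr_fun h1 x))

theorem tmulLeft_inner_ext {u v : HilbertTensor H K}
    (h : ∀ x y, ⟪u, tmulLeft x y⟫_ℂ = ⟪v, tmulLeft x y⟫_ℂ) : u = v := by
  refine ext_inner_right ℂ fun w => ?_
  exact DFunLike.congr_fun (tmulLeft_ext (f := innerSL ℂ u) (g := innerSL ℂ v) h) w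

theorem opTensor_tmulLeft (a : H →L[ℂ] H) (b : K →L[ℂ] K) (x : H) (y : K) :
    opTensor a b (tmulLeft x y) = tmulLeft (a x) (b y) := opTensor_apply a b (x ⊗ₜ y)

theorem opTensor_mul (a a' : H →L[ℂ] H) (b b' : K →L[ℂ] K) :
    opTensor a b * opTensor a' b' = opTensor (a * a') (b * b') :=
  tmulLeft_ext fun x y => by simp [opTensor_tmulLeft]

theorem opTensor_one : opTensor (1 : H →L[ℂ] H) (1 : K →L[ℂ] K) = 1 :=
  tmulLeft_ext fun x y => by simp [opTensor_tmulLeft]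

variable [CompleteSpace H] [CompleteSpace K]

theorem star_opTensor (a : H →L[ℂ] H) (b : K →L[ℂ] K) :
    star (opTensor a b) = opTensor (star a) (star b) := by
  refine tmulLeft_ext fun x y => tmulLeft_inner_ext fun x' y' => ?_
  rw [ContinuousLinearMap.star_eq_adjoint, ContinuousLinearMap.adjoint_inner_left,
    opTensor_tmulLeft, opTensor_tmulLeft, inner_tmulLeft, inner_tmulLeft,
    ContinuousLinearMap.star_eq_adjoint, ContinuousLinearMap.star_eq_adjoint,
    ContinuousLinearMap.adjoint_inner_left, ContinuousLinearMap.adjoint_inner_left]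

variable {A : StarSubalgebra ℂ (H →L[ℂ] H)} {B : StarSubalgebra ℂ (K →L[ℂ] K)}

theorem one_mem_elementaryTensors : 1 ∈ elementaryTensors A B :=
  ⟨1, one_mem A, 1, one_mem B, opTensor_one.symm⟩

theorem mul_mem_elementaryTensors {x y : HilbertTensor H K →L[ℂ] HilbertTensor H K}
    (hx : x ∈ elementaryTensors A B) (hy : y ∈ elementaryTensors A B) :
    x * y ∈ elementaryTensors A B := by
  obtain ⟨a, ha, b, hb, rfl⟩ := hx
  obtain ⟨a', ha', b', hb', rfl⟩ := hy
  exact ⟨_, mul_mem ha ha', _, mul_mem hb hb', opTensor_mul a a' b b'⟩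

theorem star_mem_elementaryTensors {x : HilbertTensor H K →L[ℂ] HilbertTensor H K}
    (hx : x ∈ elementaryTensors A B) : star x ∈ elementaryTensors A B := by
  obtain ⟨a, ha, b, hb, rfl⟩ := hx
  exact ⟨_, star_mem ha, _, star_mem hb, star_opTensor a b⟩

theorem mul_mem_span_elementaryTensors {x y : HilbertTensor H K →L[ℂ] HilbertTensor H K}
    (hx : x ∈ Submodule.span ℂ (elementaryTensors A B))
    (hy : y ∈ Submodule.span ℂ (elementaryTensors A B)) :
    x * y ∈ Submodule.span ℂ (elementaryTensors A B) := by
  have h := Submodule.mul_mem_mul hx hy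
  rw [Submodule.span_mul_span] at h
  refine Submodule.span_mono ?_ h
  rintro _ ⟨u, hu, v, hv, rfl⟩
  exact mul_mem_elementaryTensors hu hv

theorem star_mem_span_elementaryTensors {x : HilbertTensor H K →L[ℂ] HilbertTensor H K}
    (hx : x ∈ Submodule.span ℂ (elementaryTensors A B)) :
    star x ∈ Submodule.span ℂ (elementaryTensors A B) := by
  induction hx using Submodule.span_induction with
  | mem x hx => exact Submodule.subset_span (star_mem_elementaryTensors hx)
  | zero => simp
  | add x y _ _ hx hy => rw [star_add]; exact add_mem hx hy
  | smul c x _ hx => rw [star_smul]; exact Submodule.smul_mem _ _ hx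

/-- Elementary tensors contain `1` and are stable under products and adjoints, so their linear span
is already a ⋆-algebra. Claims about the spatial tensor product that define closed subspaces can
therefore be checked on elementary tensors. -/
theorem adjoin_elementaryTensors_le_span {x : HilbertTensor H K →L[ℂ] HilbertTensor H K}
    (hx : x ∈ StarAlgebra.adjoin ℂ (elementaryTensors A B)) :
    x ∈ Submodule.span ℂ (elementaryTensors A B) := by
  induction hx using StarAlgebra.adjoin_induction with
  | mem x hx => exact Submodule.subset_span hx
  | algebraMap r =>
    rw [Algebra.algebraMap_eq_smul_one]
    exact Submodule.smul_mem _ _ (Submodule.subset_span one_mem_elementaryTensors)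
  | add x y _ _ hx hy => exact add_mem hx hy
  | mul x y _ _ hx hy => exact mul_mem_span_elementaryTensors hx hy
  | star x _ hx => exact star_mem_span_elementaryTensors hx

theorem cstarTensor_subset_of_isClosed
    {S : Submodule ℂ (HilbertTensor H K →L[ℂ] HilbertTensor H K)}
    (hS : IsClosed (S : Set (HilbertTensor H K →L[ℂ] HilbertTensor H K)))
    (h : elementaryTensors A B ⊆ S) {x : HilbertTensor H K →L[ℂ] HilbertTensor H K}
    (hx : x ∈ cstarTensor A B) : x ∈ S := by
  have h1 : (StarAlgebra.adjoin ℂ (elementaryTensors A B) :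
      Set (HilbertTensor H K →L[ℂ] HilbertTensor H K)) ⊆ S :=
    fun y hy => Submodule.span_le.2 h (adjoin_elementaryTensors_le_span hy)
  exact closure_minimal h1 hS hx

theorem isClosed_cstarTensor :
    IsClosed (cstarTensor A B : Set (HilbertTensor H K →L[ℂ] HilbertTensor H K)) :=
  StarSubalgebra.isClosed_topologicalClosure _

theorem isClosed_vonNeumannTensor :
    IsClosed (vonNeumannTensor A B : Set (HilbertTensor H K →L[ℂ] HilbertTensor H K)) := by
  rw [vonNeumannTensor, StarSubalgebra.coe_centralizer]
  exact Set.isClosed_centralizer _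

theorem tmulIn_mul {T : StarSubalgebra ℂ (HilbertTensor H K →L[ℂ] HilbertTensor H K)}
    (hT : elementaryTensors A B ⊆ (T : Set _)) (a a' : A) (b b' : B) :
    tmulIn hT a b * tmulIn hT a' b' = tmulIn hT (a * a') (b * b') :=
  Subtype.ext (opTensor_mul _ _ _ _)

theorem star_tmulIn {T : StarSubalgebra ℂ (HilbertTensor H K →L[ℂ] HilbertTensor H K)}
    (hT : elementaryTensors A B ⊆ (T : Set _)) (a : A) (b : B) :
    star (tmulIn hT a b) = tmulIn hT (star a) (star b) :=
  Subtype.ext (star_opTensor _ _)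

theorem tmulIn_one {T : StarSubalgebra ℂ (HilbertTensor H K →L[ℂ] HilbertTensor H K)}
    (hT : elementaryTensors A B ⊆ (T : Set _)) : tmulIn hT 1 1 = 1 :=
  Subtype.ext opTensor_one

/-- The slice `(⟨x| ⊗ 1) y (|x'⟩ ⊗ 1)` of an operator. -/
def slice (x x' : H) : (HilbertTensor H K →L[ℂ] HilbertTensor H K) →ₗ[ℂ] (K →L[ℂ] K) where
  toFun y := (ContinuousLinearMap.adjoint (tmulLeft x)) ∘L y ∘L tmulLeft x'
  map_add' y z := by simp
  map_smul' c y := by simp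

theorem inner_slice (x x' : H) (y : HilbertTensor H K →L[ℂ] HilbertTensor H K) (k k' : K) :
    ⟪k, slice x x' y k'⟫_ℂ = ⟪tmulLeft x k, y (tmulLeft x' k')⟫_ℂ :=
  ContinuousLinearMap.adjoint_inner_right (tmulLeft x) k (y (tmulLeft x' k'))

theorem slice_add_left (x z x' : H) (y : HilbertTensor H K →L[ℂ] HilbertTensor H K) :
    slice (x + z) x' y = slice x x' y + slice z x' y := by
  simp [slice, tmulLeft_add]

theorem slice_smul_left (c : ℂ) (x x' : H) (y : HilbertTensor H K →L[ℂ] HilbertTensor H K) :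
    slice (c • x) x' y = (starRingEnd ℂ c) • slice x x' y := by
  simp only [slice, tmulLeft_smul, LinearMap.coe_mk, AddHom.coe_mk]
  rw [LinearIsometryEquiv.map_smulₛₗ, ContinuousLinearMap.smul_comp]

theorem slice_add_right (x x' z : H) (y : HilbertTensor H K →L[ℂ] HilbertTensor H K) :
    slice x (x' + z) y = slice x x' y + slice x z y := by
  simp [slice, tmulLeft_add]

theorem slice_smul_right (c : ℂ) (x x' : H) (y : HilbertTensor H K →L[ℂ] HilbertTensor H K) :
    slice x (c • x') y = c • slice x x' y := by
  simp [slice, tmulLeft_smul]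

theorem norm_slice_le (x x' : H) (y : HilbertTensor H K →L[ℂ] HilbertTensor H K) :
    ‖slice x x' y‖ ≤ ‖y‖ * ‖x‖ * ‖x'‖ := by
  calc ‖slice x x' y‖ ≤ ‖ContinuousLinearMap.adjoint (tmulLeft (K := K) x)‖ *
        (‖y‖ * ‖(tmulLeft x' : K →L[ℂ] _)‖) :=
        (ContinuousLinearMap.opNorm_comp_le _ _).trans
          (mul_le_mul_of_nonneg_left (ContinuousLinearMap.opNorm_comp_le _ _) (norm_nonneg _))
    _ ≤ ‖x‖ * (‖y‖ * ‖x'‖) := by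
        rw [LinearIsometryEquiv.norm_map]
        gcongr <;> exact norm_tmulLeft_le _
    _ = ‖y‖ * ‖x‖ * ‖x'‖ := by ring

theorem slice_opTensor (x x' : H) (a : H →L[ℂ] H) (b : K →L[ℂ] K) :
    slice x x' (opTensor a b) = ⟪x, a x'⟫_ℂ • b := by
  ext k'
  refine ext_inner_left ℂ fun k => ?_
  rw [inner_slice, opTensor_tmulLeft, inner_tmulLeft, _root_.smul_apply, inner_smul_right]

/-- The quadratic form of this slice at `k` is `‖y (x ⊗ k)‖²`. -/
theorem slice_star_mul_self_nonneg (x : H) (y : HilbertTensor H K →L[ℂ] HilbertTensor H K) :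
    0 ≤ slice x x (star y * y) := by
  refine nonneg_of_inner_nonneg fun k => ?_
  rw [inner_slice, mul_apply_eq_comp, ContinuousLinearMap.star_eq_adjoint,
    ContinuousLinearMap.adjoint_inner_right]
  exact zero_le_inner_self _

theorem continuous_slice (x x' : H) :
    Continuous (slice x x' : (HilbertTensor H K →L[ℂ] HilbertTensor H K) →ₗ[ℂ] (K →L[ℂ] K)) :=
  AddMonoidHomClass.continuous_of_bound (slice x x') (‖x‖ * ‖x'‖) fun y => by
    rw [mul_comm, ← mul_assoc]; exact norm_slice_le x x' y

/-- The operators whose slice lies in `B` form a closed subspace, and the slices of `a ⊗ b` are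
multiples of `b`. -/
theorem slice_mem (hB : IsClosed (B : Set (K →L[ℂ] K))) (x x' : H)
    {y : HilbertTensor H K →L[ℂ] HilbertTensor H K} (hy : y ∈ cstarTensor A B) :
    slice x x' y ∈ B :=
  cstarTensor_subset_of_isClosed (A := A) (B := B)
    (S := B.toSubalgebra.toSubmodule.comap (slice x x'))
    (hB.preimage (continuous_slice x x')) (by
      rintro _ ⟨a, -, b, hb, rfl⟩
      change slice x x' (opTensor a b) ∈ B
      rw [slice_opTensor]
      exact SMulMemClass.smul_mem _ hb) hy

end OperatorTensor

section OperatorTensor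

variable {H K : Type*} [NormedAddCommGroup H] [InnerProductSpace ℂ H]
  [NormedAddCommGroup K] [InnerProductSpace ℂ K]
  [CompleteSpace H] [CompleteSpace K]
  {A : StarSubalgebra ℂ (H →L[ℂ] H)} {B : StarSubalgebra ℂ (K →L[ℂ] K)}

/-- The slices of an element of the spatial tensor product lie in the second factor. -/
def sliceIn (A : StarSubalgebra ℂ (H →L[ℂ] H)) (hB : IsClosed (B : Set (K →L[ℂ] K))) (x x' : H) :
    cstarTensor A B →ₗ[ℂ] B where
  toFun y := ⟨slice x x' y, slice_mem hB x x' y.2⟩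
  map_add' y z := Subtype.ext (map_add (slice x x') y.1 z.1)
  map_smul' c y := Subtype.ext (map_smul (slice x x') c y.1)

theorem sliceIn_add_left (hB : IsClosed (B : Set (K →L[ℂ] K))) (x z x' : H)
    (y : cstarTensor A B) : sliceIn A hB (x + z) x' y = sliceIn A hB x x' y + sliceIn A hB z x' y :=
  Subtype.ext (slice_add_left x z x' y.1)

theorem sliceIn_smul_left (hB : IsClosed (B : Set (K →L[ℂ] K))) (c : ℂ) (x x' : H)
    (y : cstarTensor A B) : sliceIn A hB (c • x) x' y = (starRingEnd ℂ c) • sliceIn A hB x x' y :=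
  Subtype.ext (slice_smul_left c x x' y.1)

theorem sliceIn_add_right (hB : IsClosed (B : Set (K →L[ℂ] K))) (x x' z : H)
    (y : cstarTensor A B) : sliceIn A hB x (x' + z) y = sliceIn A hB x x' y + sliceIn A hB x z y :=
  Subtype.ext (slice_add_right x x' z y.1)

theorem sliceIn_smul_right (hB : IsClosed (B : Set (K →L[ℂ] K))) (c : ℂ) (x x' : H)
    (y : cstarTensor A B) : sliceIn A hB x (c • x') y = c • sliceIn A hB x x' y :=
  Subtype.ext (slice_smul_right c x x' y.1)

theorem norm_state_sliceIn_le (hB : IsClosed (B : Set (K →L[ℂ] K))) (ψ : State B) (x x' : H)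
    (y : cstarTensor A B) : ‖ψ.toLinearMap (sliceIn A hB x x' y)‖ ≤ ‖y‖ * ‖x‖ * ‖x'‖ :=
  (ψ.norm_le hB _).trans (norm_slice_le x x' y.1)

/-- The right-hand side is a sesquilinear form in `x, x'` bounded by `‖y‖`, hence given by an
operator, which will be `(id ⊗ ψ) y`. -/
theorem exists_sliceOperator (hB : IsClosed (B : Set (K →L[ℂ] K))) (ψ : State B)
    (y : cstarTensor A B) :
    ∃ R : H →L[ℂ] H, ∀ x x', ⟪x, R x'⟫_ℂ = ψ.toLinearMap (sliceIn A hB x x' y) := by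
  let f : H →ₛₗ[starRingEnd ℂ] H →ₗ[ℂ] ℂ := LinearMap.mk₂'ₛₗ (starRingEnd ℂ) (RingHom.id ℂ)
      (fun x x' => ψ.toLinearMap (sliceIn A hB x x' y))
      (fun x z x' => by rw [sliceIn_add_left, map_add])
      (fun c x x' => by rw [sliceIn_smul_left, map_smul])
      (fun x x' z => by rw [sliceIn_add_right, map_add])
      (fun c x x' => by rw [sliceIn_smul_right, map_smul]; rfl)
  let β : H →L⋆[ℂ] H →L[ℂ] ℂ :=
    LinearMap.mkContinuous₂ f ‖y‖ (fun x x' => norm_state_sliceIn_le hB ψ x x' y)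
  -- The Riesz operator of `β` acts in the first slot of the inner product; the adjoint moves it to
  -- the second.
  refine ⟨ContinuousLinearMap.adjoint (InnerProductSpace.continuousLinearMapOfBilin β),
    fun x x' => ?_⟩
  rw [ContinuousLinearMap.adjoint_inner_right, InnerProductSpace.continuousLinearMapOfBilin_apply]
  rfl

theorem operator_ext_inner {S S' : H →L[ℂ] H} (h : ∀ x x', ⟪x, S x'⟫_ℂ = ⟪x, S' x'⟫_ℂ) : S = S' :=
  ContinuousLinearMap.ext fun x' => ext_inner_left ℂ fun x => h x x'

theorem exists_continuous_sliceMap (hB : IsClosed (B : Set (K →L[ℂ] K))) (ψ : State B) :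
    ∃ R : cstarTensor A B →L[ℂ] (H →L[ℂ] H),
      ∀ y x x', ⟪x, R y x'⟫_ℂ = ψ.toLinearMap (sliceIn A hB x x' y) := by
  choose R₀ hR using fun y : cstarTensor A B => exists_sliceOperator hB ψ y
  have hadd : ∀ y z, R₀ (y + z) = R₀ y + R₀ z := fun y z => operator_ext_inner fun x x' => by
    rw [_root_.add_apply, inner_add_right, hR, hR, hR, map_add, map_add]
  have hsmul : ∀ (c : ℂ) y, R₀ (c • y) = c • R₀ y := fun c y => operator_ext_inner fun x x' => by
    rw [_root_.smul_apply, inner_smul_right, hR, hR, map_smul, map_smul, smul_eq_mul]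
  have hnorm : ∀ y, ‖R₀ y‖ ≤ 1 * ‖y‖ := fun y => by
    rw [one_mul]
    refine ContinuousLinearMap.opNorm_le_bound _ (norm_nonneg _) fun x => ?_
    -- The form bound is tested at the vector `R₀ y x` itself; one factor cancels afterwards.
    have h1 : ‖R₀ y x‖ ^ 2 ≤ ‖y‖ * ‖R₀ y x‖ * ‖x‖ := by
      have := norm_state_sliceIn_le hB ψ (R₀ y x) x y
      rw [← hR, inner_self_eq_norm_sq_to_K] at this
      simpa using this
    by_cases h0 : ‖R₀ y x‖ = 0
    · rw [h0]; positivity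
    · have h0' : 0 < ‖R₀ y x‖ := lt_of_le_of_ne (norm_nonneg _) (Ne.symm h0)
      nlinarith
  let R₁ : cstarTensor A B →ₗ[ℂ] (H →L[ℂ] H) :=
    { toFun := R₀, map_add' := hadd, map_smul' := hsmul }
  exact ⟨R₁.mkContinuous 1 hnorm, hR⟩

/-- Closed subspaces containing the elementary tensors are everything. -/
theorem cstarTensor_eq_top {S : Submodule ℂ (cstarTensor A B)}
    (hS : IsClosed (S : Set (cstarTensor A B)))
    (h : ∀ a b, tmulIn (elementaryTensors_subset_cstarTensor A B) a b ∈ S) (y : cstarTensor A B) :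
    y ∈ S := by
  have hcl : IsClosed (S.map (cstarTensor A B).subtype.toAlgHom.toLinearMap :
      Set (HilbertTensor H K →L[ℂ] HilbertTensor H K)) := by
    rw [Submodule.map_coe]
    exact (isClosed_cstarTensor (A := A) (B := B)).isClosedEmbedding_subtypeVal.isClosedMap _ hS
  obtain ⟨z, hz, hzy⟩ := cstarTensor_subset_of_isClosed hcl (by
    rintro _ ⟨a, ha, b, hb, rfl⟩
    exact ⟨tmulIn (elementaryTensors_subset_cstarTensor A B) ⟨a, ha⟩ ⟨b, hb⟩, h _ _, rfl⟩) y.2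
  have : z = y := Subtype.ext hzy
  exact this ▸ hz

/-- Continuous functionals on the spatial tensor product are determined by elementary tensors. -/
theorem cstarTensor_functional_ext {f g : cstarTensor A B →ₗ[ℂ] ℂ} (hf : Continuous f)
    (hg : Continuous g)
    (h : ∀ a b, f (tmulIn (elementaryTensors_subset_cstarTensor A B) a b) =
      g (tmulIn (elementaryTensors_subset_cstarTensor A B) a b)) : f = g :=
  LinearMap.ext fun y => sub_eq_zero.1 <| cstarTensor_eq_top (S := LinearMap.ker (f - g))
    (isClosed_eq (f := fun x => (f - g) x) (hf.sub hg) continuous_const)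
    (fun a b => by simp [h]) y

/-- The slice map of a state on the second factor. -/
theorem exists_sliceMap (hA : IsClosed (A : Set (H →L[ℂ] H))) (hB : IsClosed (B : Set (K →L[ℂ] K)))
    (ψ : State B) : ∃ R : cstarTensor A B →L[ℂ] (H →L[ℂ] H), (∀ y, R y ∈ A) ∧
      (∀ a b, R (tmulIn (elementaryTensors_subset_cstarTensor A B) a b) =
        ψ.toLinearMap b • (a : H →L[ℂ] H)) ∧ ∀ y, 0 ≤ R (star y * y) := by
  obtain ⟨R, hR⟩ := exists_continuous_sliceMap (A := A) hB ψ
  have htm : ∀ a b, R (tmulIn (elementaryTensors_subset_cstarTensor A B) a b) =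
      ψ.toLinearMap b • (a : H →L[ℂ] H) := fun a b => operator_ext_inner fun x x' => by
    have h1 : sliceIn A hB x x' (tmulIn (elementaryTensors_subset_cstarTensor A B) a b) =
        ⟪x, (a : H →L[ℂ] H) x'⟫_ℂ • b := Subtype.ext (slice_opTensor x x' a.1 b.1)
    rw [hR, h1, map_smul, _root_.smul_apply, inner_smul_right, smul_eq_mul, mul_comm]
  refine ⟨R, fun y => ?_, htm, fun y => ?_⟩
  · refine cstarTensor_eq_top (S := A.toSubalgebra.toSubmodule.comap R.toLinearMap)
      (hA.preimage R.continuous) (fun a b => ?_) y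
    change R _ ∈ A
    rw [htm]
    exact SMulMemClass.smul_mem _ a.2
  · refine nonneg_of_inner_nonneg fun x => ?_
    rw [hR]
    exact ψ.nonneg hB (slice_star_mul_self_nonneg x y.1)

/-- Product states on the spatial tensor product exist. -/
theorem exists_productState (hA : IsClosed (A : Set (H →L[ℂ] H)))
    (hB : IsClosed (B : Set (K →L[ℂ] K))) (φ : State A) (ψ : State B) :
    ∃ Φ : State (cstarTensor A B),
      IsProductState (elementaryTensors_subset_cstarTensor A B) φ ψ Φ := by
  obtain ⟨R, hRA, hR, hpos⟩ := exists_sliceMap hA hB ψ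
  set R' : cstarTensor A B →ₗ[ℂ] A :=
    { toFun := fun y => ⟨R y, hRA y⟩
      map_add' := fun y z => Subtype.ext (map_add R y z)
      map_smul' := fun c y => Subtype.ext (map_smul R c y) } with hR'
  have hRt : ∀ a b, R' (tmulIn (elementaryTensors_subset_cstarTensor A B) a b) =
      ψ.toLinearMap b • a := fun a b => Subtype.ext (hR a b)
  have hprod : ∀ a b, φ.toLinearMap (R' (tmulIn (elementaryTensors_subset_cstarTensor A B) a b)) =
      φ.toLinearMap a * ψ.toLinearMap b := fun a b => by
    rw [hRt, map_smul, smul_eq_mul, mul_comm]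
  -- `R (star y * y)` is known to be positive only as an operator on `H`; closedness of `A` turns
  -- this into positivity under `φ`.
  refine ⟨State.ofLinearMap (φ.toLinearMap ∘ₗ R') ?_ (fun y => φ.nonneg hA (hpos y))
    (φ.continuous_toLinearMap.comp (R.continuous.subtype_mk hRA)), hprod⟩
  rw [LinearMap.comp_apply, ← tmulIn_one (elementaryTensors_subset_cstarTensor A B), hprod,
    φ.map_one, ψ.map_one, mul_one]

end OperatorTensor

/-! ### Restriction to the subsystem and the doubled subsystem -/

section Subsystems

variable {H₁ H₂ : Type*} [NormedAddCommGroup H₁] [InnerProductSpace ℂ H₁] [CompleteSpace H₁]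
  [FiniteDimensional ℂ H₁] [NormedAddCommGroup H₂] [InnerProductSpace ℂ H₂] [CompleteSpace H₂]
  {M : StarSubalgebra ℂ (H₂ →L[ℂ] H₂)}
  {A : StarSubalgebra ℂ (HilbertTensor H₁ H₂ →L[ℂ] HilbertTensor H₁ H₂)}
  {T : StarSubalgebra ℂ (HilbertTensor (HilbertTensor H₁ H₂) (HilbertTensor H₁ H₂) →L[ℂ]
    HilbertTensor (HilbertTensor H₁ H₂) (HilbertTensor H₁ H₂))}

theorem subsystem_apply
    (hA : elementaryTensors (⊤ : StarSubalgebra ℂ (H₁ →L[ℂ] H₁)) M ⊆ (A : Set _))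
    (X : H₁ →L[ℂ] H₁) : subsystem hA X = tmulIn hA ⟨X, StarSubalgebra.mem_top⟩ 1 := rfl

theorem subsystem_one
    (hA : elementaryTensors (⊤ : StarSubalgebra ℂ (H₁ →L[ℂ] H₁)) M ⊆ (A : Set _)) :
    subsystem hA 1 = 1 := tmulIn_one hA

theorem subsystem_star_mul
    (hA : elementaryTensors (⊤ : StarSubalgebra ℂ (H₁ →L[ℂ] H₁)) M ⊆ (A : Set _))
    (X Y : H₁ →L[ℂ] H₁) : subsystem hA (star X * Y) = star (subsystem hA X) * subsystem hA Y := by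
  rw [subsystem_apply, subsystem_apply, subsystem_apply, star_tmulIn, tmulIn_mul, star_one, one_mul]
  rfl

theorem isStateFunctional_subsystem
    (hA : elementaryTensors (⊤ : StarSubalgebra ℂ (H₁ →L[ℂ] H₁)) M ⊆ (A : Set _)) (φ : State A) :
    IsStateFunctional (φ.toLinearMap ∘ₗ subsystem hA) := by
  refine ⟨by rw [LinearMap.comp_apply, subsystem_one, φ.map_one], fun X => ?_⟩
  rw [LinearMap.comp_apply, subsystem_star_mul]
  exact φ.nonneg_star_mul_self _

theorem doubledSubsystem_mapL
    (hA : elementaryTensors (⊤ : StarSubalgebra ℂ (H₁ →L[ℂ] H₁)) M ⊆ (A : Set _))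
    (hT : elementaryTensors A A ⊆ (T : Set _)) (X Y : H₁ →L[ℂ] H₁) :
    doubledSubsystem hA hT (TensorProduct.mapL X Y) =
      tmulIn hT (subsystem hA X) (subsystem hA Y) := by
  rw [doubledSubsystem, liftOperators_mapL]
  rfl

/-- In finite dimension the operators `a ⊗ b` span all operators on `H ⊗ K`. -/
theorem mapL_induction {H K : Type*} [NormedAddCommGroup H] [InnerProductSpace ℂ H]
    [FiniteDimensional ℂ H] [NormedAddCommGroup K] [InnerProductSpace ℂ K]
    [FiniteDimensional ℂ K] {P : (H ⊗[ℂ] K →L[ℂ] H ⊗[ℂ] K) → Prop}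
    (hP : ∀ a b, P (TensorProduct.mapL a b)) (h0 : P 0) (hadd : ∀ x y, P x → P y → P (x + y))
    (Z : H ⊗[ℂ] K →L[ℂ] H ⊗[ℂ] K) : P Z := by
  obtain ⟨t, ht⟩ := (homTensorHomEquiv ℂ H K H K).surjective Z.toLinearMap
  have key : ∀ t, P (LinearMap.toContinuousLinearMap (homTensorHomEquiv ℂ H K H K t)) := by
    intro t
    induction t using TensorProduct.induction_on with
    | zero => rw [_root_.map_zero, _root_.map_zero]; exact h0
    | tmul a b =>
      convert hP (LinearMap.toContinuousLinearMap a) (LinearMap.toContinuousLinearMap b) using 1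
      ext x
      simp [homTensorHomEquiv_apply]
    | add x y hx hy => rw [_root_.map_add, _root_.map_add]; exact hadd _ _ hx hy
  have := key t
  rw [ht] at this
  exact this

theorem doubledSubsystem_star_mul_mapL
    (hA : elementaryTensors (⊤ : StarSubalgebra ℂ (H₁ →L[ℂ] H₁)) M ⊆ (A : Set _))
    (hT : elementaryTensors A A ⊆ (T : Set _)) (a b c d : H₁ →L[ℂ] H₁) :
    doubledSubsystem hA hT (TensorProduct.mapL (star a) (star b) * TensorProduct.mapL c d) =
      star (doubledSubsystem hA hT (TensorProduct.mapL a b)) *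
        doubledSubsystem hA hT (TensorProduct.mapL c d) := by
  rw [← TensorProduct.mapL_mul, doubledSubsystem_mapL hA hT (star a * c) (star b * d),
    doubledSubsystem_mapL hA hT a b, doubledSubsystem_mapL hA hT c d,
    star_tmulIn hT (subsystem hA a) (subsystem hA b), tmulIn_mul hT,
    subsystem_star_mul hA a c, subsystem_star_mul hA b d]

/-- Both sides are conjugate-linear in `X` and linear in `Y`, so operators `a ⊗ b` suffice. It
transfers positivity of a state to its restriction along the doubled subsystem. -/
theorem adjoint_mul_of_mapL {H K R : Type*} [NormedAddCommGroup H] [InnerProductSpace ℂ H]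
    [CompleteSpace H] [FiniteDimensional ℂ H] [NormedAddCommGroup K] [InnerProductSpace ℂ K]
    [CompleteSpace K] [FiniteDimensional ℂ K] [CompleteSpace (H ⊗[ℂ] K)] [Ring R] [StarRing R]
    [Module ℂ R] (κ : (H ⊗[ℂ] K →L[ℂ] H ⊗[ℂ] K) →ₗ[ℂ] R)
    (h : ∀ a b c d, κ (TensorProduct.mapL (star a) (star b) * TensorProduct.mapL c d) =
      star (κ (TensorProduct.mapL a b)) * κ (TensorProduct.mapL c d))
    (X Y : H ⊗[ℂ] K →L[ℂ] H ⊗[ℂ] K) :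
    κ (ContinuousLinearMap.adjoint X * Y) = star (κ X) * κ Y := by
  induction X using mapL_induction with
  | h0 => rw [map_zero, zero_mul, map_zero, star_zero, zero_mul]
  | hadd x y hx hy => rw [map_add, add_mul, map_add, map_add, star_add, add_mul, hx, hy]
  | hP a b =>
    rw [TensorProduct.adjoint_mapL]
    induction Y using mapL_induction with
    | h0 => rw [mul_zero, map_zero, mul_zero]
    | hadd x y hx hy => rw [mul_add, map_add, map_add, mul_add, hx, hy]
    | hP c d => exact h a b c d

theorem doubledSubsystem_star_mul [CompleteSpace (H₁ ⊗[ℂ] H₁)]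
    (hA : elementaryTensors (⊤ : StarSubalgebra ℂ (H₁ →L[ℂ] H₁)) M ⊆ (A : Set _))
    (hT : elementaryTensors A A ⊆ (T : Set _)) (X Y : H₁ ⊗[ℂ] H₁ →L[ℂ] H₁ ⊗[ℂ] H₁) :
    doubledSubsystem hA hT (ContinuousLinearMap.adjoint X * Y) =
      star (doubledSubsystem hA hT X) * doubledSubsystem hA hT Y :=
  adjoint_mul_of_mapL _ (doubledSubsystem_star_mul_mapL hA hT) X Y

theorem isStateFunctional_doubledSubsystem
    (hA : elementaryTensors (⊤ : StarSubalgebra ℂ (H₁ →L[ℂ] H₁)) M ⊆ (A : Set _))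
    (hT : elementaryTensors A A ⊆ (T : Set _)) (φ : State T) :
    letI : CompleteSpace (H₁ ⊗[ℂ] H₁) := FiniteDimensional.complete ℂ _
    IsStateFunctional (φ.toLinearMap ∘ₗ doubledSubsystem hA hT) := by
  have : CompleteSpace (H₁ ⊗[ℂ] H₁) := FiniteDimensional.complete ℂ _
  refine ⟨?_, fun X => ?_⟩
  · have h1 : (1 : H₁ ⊗[ℂ] H₁ →L[ℂ] H₁ ⊗[ℂ] H₁) = TensorProduct.mapL 1 1 :=
      TensorProduct.mapL_id_id.symm
    rw [LinearMap.comp_apply, h1, doubledSubsystem_mapL, subsystem_one, tmulIn_one, φ.map_one]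
  · rw [LinearMap.comp_apply, ContinuousLinearMap.star_eq_adjoint, doubledSubsystem_star_mul]
    exact φ.nonneg_star_mul_self _

end Subsystems

/-! ### Amplification to `ℓ² ⊗ L` and the bicommutant argument -/

section Amplification

variable {L ι : Type*} [NormedAddCommGroup L] [InnerProductSpace ℂ L]

/-- The Hilbert space `ℓ²(ι) ⊗ L` of square summable families. -/
abbrev SquareSummable (ι L : Type*) [NormedAddCommGroup L] [InnerProductSpace ℂ L] : Type _ :=
  lp (fun _ : ι => L) 2

theorem SquareSummable.hasSum_norm_sq (x : SquareSummable ι L) :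
    HasSum (fun i => ‖x i‖ ^ 2) (‖x‖ ^ 2) := by
  simpa using lp.hasSum_norm (p := 2) (by simp) x

theorem memlp_two_iff {f : ι → L} : Memℓp f 2 ↔ Summable fun i => ‖f i‖ ^ 2 := by
  simpa using memℓp_gen_iff (p := 2) (E := fun _ : ι => L) (f := f) (by simp)

theorem norm_sq_apply_le (a : L →L[ℂ] L) (v : L) : ‖a v‖ ^ 2 ≤ ‖a‖ ^ 2 * ‖v‖ ^ 2 := by
  rw [← mul_pow]
  gcongr
  exact a.le_opNorm _

theorem memlp_amplify (a : L →L[ℂ] L) (x : SquareSummable ι L) :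
    Memℓp (fun i => a (x i)) 2 :=
  memlp_two_iff.2 (Summable.of_nonneg_of_le (fun _ => sq_nonneg _)
    (fun i => norm_sq_apply_le a (x i)) (x.hasSum_norm_sq.summable.mul_left _))

/-- The operator `1 ⊗ a` on `ℓ²(ι) ⊗ L`, as a linear map. -/
def amplifyₗ (ι : Type*) (a : L →L[ℂ] L) : SquareSummable ι L →ₗ[ℂ] SquareSummable ι L where
  toFun x := ⟨fun i => a (x i), memlp_amplify a x⟩
  map_add' x y := lp.ext (funext fun i => map_add a (x i) (y i))
  map_smul' c x := lp.ext (funext fun i => map_smul a c (x i))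

theorem norm_amplifyₗ_le (a : L →L[ℂ] L) (x : SquareSummable ι L) :
    ‖amplifyₗ ι a x‖ ≤ ‖a‖ * ‖x‖ := by
  have h : ‖amplifyₗ ι a x‖ ^ 2 ≤ (‖a‖ * ‖x‖) ^ 2 := by
    rw [mul_pow]
    exact hasSum_le (fun i => norm_sq_apply_le a (x i)) (amplifyₗ ι a x).hasSum_norm_sq
      (x.hasSum_norm_sq.mul_left _)
  exact (sq_le_sq₀ (norm_nonneg _) (by positivity)).1 h

/-- The operator `1 ⊗ a` on `ℓ²(ι) ⊗ L`. -/
def amplify (ι : Type*) (a : L →L[ℂ] L) : SquareSummable ι L →L[ℂ] SquareSummable ι L :=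
  (amplifyₗ ι a).mkContinuous ‖a‖ (norm_amplifyₗ_le a)

theorem amplify_apply (a : L →L[ℂ] L) (x : SquareSummable ι L) (i : ι) :
    amplify ι a x i = a (x i) := rfl

theorem norm_amplify_le (a : L →L[ℂ] L) : ‖amplify ι a‖ ≤ ‖a‖ :=
  LinearMap.mkContinuous_norm_le _ (norm_nonneg _) _

theorem amplify_add (a b : L →L[ℂ] L) : amplify ι (a + b) = amplify ι a + amplify ι b := by
  ext x i; rfl

theorem amplify_smul (c : ℂ) (a : L →L[ℂ] L) : amplify ι (c • a) = c • amplify ι a := by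
  ext x i; rfl

theorem amplify_mul (a b : L →L[ℂ] L) : amplify ι (a * b) = amplify ι a * amplify ι b := by
  ext x i; rfl

theorem amplify_one : amplify ι (1 : L →L[ℂ] L) = 1 := by
  ext x i; rfl

theorem hasSum_inner_amplify (θ ζ : SquareSummable ι L) (a : L →L[ℂ] L) :
    HasSum (fun i => ⟪θ i, a (ζ i)⟫_ℂ) ⟪θ, amplify ι a ζ⟫_ℂ :=
  lp.hasSum_inner θ (amplify ι a ζ)

/-- `a ↦ (1 ⊗ a) ζ`. -/
def amplifyVec (ζ : SquareSummable ι L) : (L →L[ℂ] L) →ₗ[ℂ] SquareSummable ι L where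
  toFun a := amplify ι a ζ
  map_add' a b := by rw [amplify_add]; rfl
  map_smul' c a := by rw [amplify_smul]; rfl

theorem amplifyVec_apply (ζ : SquareSummable ι L) (a : L →L[ℂ] L) :
    amplifyVec ζ a = amplify ι a ζ := rfl

theorem amplify_amplifyVec (ζ : SquareSummable ι L) (a b : L →L[ℂ] L) :
    amplify ι a (amplifyVec ζ b) = amplifyVec ζ (a * b) := by
  rw [amplifyVec_apply, amplifyVec_apply, amplify_mul, mul_apply_eq_comp]

variable [CompleteSpace L]

theorem adjoint_amplify (a : L →L[ℂ] L) :
    ContinuousLinearMap.adjoint (amplify ι a) = amplify ι (star a) := by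
  symm
  rw [ContinuousLinearMap.eq_adjoint_iff]
  intro x y
  refine (lp.hasSum_inner _ _).unique ?_
  convert! hasSum_inner_amplify x y a using 2 with i
  rw [amplify_apply, ContinuousLinearMap.star_eq_adjoint, ContinuousLinearMap.adjoint_inner_left]

theorem inner_amplify_star_mul (ζ : SquareSummable ι L) (a b : L →L[ℂ] L) :
    ⟪ζ, amplify ι (star a * b) ζ⟫_ℂ = ⟪amplifyVec ζ a, amplifyVec ζ b⟫_ℂ := by
  rw [amplify_mul, mul_apply_eq_comp, ← adjoint_amplify, ContinuousLinearMap.adjoint_inner_right]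
  rfl

/-- `W` reduces `g`: as `g⋆` preserves `W`, `g` preserves its orthogonal complement, so `g x` splits
into `g (P x) ∈ W` and a part orthogonal to `W`. -/
theorem commute_starProjection {H : Type*} [NormedAddCommGroup H] [InnerProductSpace ℂ H]
    [CompleteSpace H] {W : Submodule ℂ H} [W.HasOrthogonalProjection] {g : H →L[ℂ] H}
    (h1 : ∀ w ∈ W, g w ∈ W) (h2 : ∀ w ∈ W, ContinuousLinearMap.adjoint g w ∈ W) :
    Commute g W.starProjection := by
  refine ContinuousLinearMap.ext fun x => ?_
  rw [mul_apply_eq_comp, mul_apply_eq_comp]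
  refine (Submodule.eq_starProjection_of_mem_of_inner_eq_zero
    (h1 _ (Submodule.starProjection_apply_mem W x)) fun w hw => ?_).symm
  rw [← map_sub, ← ContinuousLinearMap.adjoint_inner_right]
  exact Submodule.starProjection_inner_eq_zero x _ (h2 w hw)

/-- The projection onto the closure of `(1 ⊗ N) ζ` commutes with `1 ⊗ a`, if `N` is invariant under
left multiplication by `a` and `a⋆`. -/
theorem commute_amplify_starProjection (ζ : SquareSummable ι L) (N : Submodule ℂ (L →L[ℂ] L))
    {a : L →L[ℂ] L} (h1 : ∀ b ∈ N, a * b ∈ N) (h2 : ∀ b ∈ N, star a * b ∈ N) :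
    Commute (amplify ι a) (N.map (amplifyVec ζ)).topologicalClosure.starProjection := by
  have key : ∀ c : L →L[ℂ] L, (∀ b ∈ N, c * b ∈ N) →
      ∀ w ∈ (N.map (amplifyVec ζ)).topologicalClosure,
        amplify ι c w ∈ (N.map (amplifyVec ζ)).topologicalClosure := by
    intro c hc w hw
    refine map_mem_closure (amplify ι c).continuous hw ?_
    rintro _ ⟨b, hb, rfl⟩
    rw [amplify_amplifyVec]
    exact ⟨_, hc b hb, rfl⟩
  refine commute_starProjection (key a h1) ?_
  rw [adjoint_amplify]
  exact key _ h2

/-- Bounded operators on `ℓ²(ι) ⊗ L` that commute with `1 ⊗ E` commute with `1 ⊗ E''`. -/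
theorem commute_amplify_of_mem_centralizer {E : Set (L →L[ℂ] L)} (hE : ∀ g ∈ E, star g ∈ E)
    {x : L →L[ℂ] L}
    (hx : x ∈ StarSubalgebra.centralizer ℂ (StarSubalgebra.centralizer ℂ E : Set (L →L[ℂ] L)))
    {P : SquareSummable ι L →L[ℂ] SquareSummable ι L} (hP : ∀ g ∈ E, Commute (amplify ι g) P) :
    Commute (amplify ι x) P := by
  classical
  set J : ι → L →L[ℂ] SquareSummable ι L := lp.singleContinuousLinearMap ℂ (fun _ : ι => L) 2
    with hJ
  have hJa : ∀ (a : L →L[ℂ] L) i v, amplify ι a (J i v) = J i (a v) := by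
    intro a i v
    ext k
    rw [amplify_apply, hJ, lp.singleContinuousLinearMap_apply, lp.singleContinuousLinearMap_apply,
      lp.single_apply, lp.single_apply]
    by_cases hk : k = i
    · subst hk; simp
    · simp [Pi.single_eq_of_ne hk]
  -- The `Q i j` are the matrix entries of `P`. Each of them commutes with the self-adjoint set `E`,
  -- so it lies in the commutant, and therefore `x` commutes with it.
  set Q : ι → ι → L →L[ℂ] L := fun i j => ContinuousLinearMap.adjoint (J i) ∘L P ∘L J j with hQ
  have hJadj : ∀ i (y : SquareSummable ι L), ContinuousLinearMap.adjoint (J i) y = y i := by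
    intro i y
    refine ext_inner_left ℂ fun v => ?_
    rw [ContinuousLinearMap.adjoint_inner_right]
    exact lp.inner_single_left (𝕜 := ℂ) (G := fun _ : ι => L) i v y
  have hQa : ∀ i j v, Q i j v = P (J j v) i := fun i j v => hJadj i _
  have hcomm : ∀ g ∈ E, ∀ i j, g * Q i j = Q i j * g := by
    intro g hg i j
    ext v
    rw [mul_apply_eq_comp, mul_apply_eq_comp, hQa, hQa, ← hJa, ← amplify_apply]
    exact congrArg (fun y : SquareSummable ι L => y i)
      (DFunLike.congr_fun (hP g hg).eq (J j v))
  have hQx : ∀ i j, Q i j * x = x * Q i j := by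
    intro i j
    have h1 : Q i j ∈ StarSubalgebra.centralizer ℂ E := by
      rw [StarSubalgebra.mem_centralizer_iff]
      exact fun g hg => ⟨hcomm g hg i j, hcomm _ (hE g hg) i j⟩
    rw [StarSubalgebra.mem_centralizer_iff] at hx
    exact (hx _ h1).1
  refine lp.ext_continuousLinearMap (by simp) fun j => ?_
  ext v i
  change amplify ι x (P (J j v)) i = P (amplify ι x (J j v)) i
  rw [amplify_apply, hJa, ← hQa, ← hQa]
  exact (DFunLike.congr_fun (hQx i j) v).symm

/-- The density theorem in dual form: a functional `⟪θ, (1 ⊗ ·) ζ⟫` that vanishes on a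
multiplicative self-adjoint set vanishes on its double commutant. -/
theorem inner_amplify_eq_zero_of_mem_centralizer {E : Set (L →L[ℂ] L)} (h1 : 1 ∈ E)
    (hmul : ∀ g ∈ E, ∀ h ∈ E, g * h ∈ E) (hE : ∀ g ∈ E, star g ∈ E) {θ ζ : SquareSummable ι L}
    (h0 : ∀ g ∈ E, ⟪θ, amplify ι g ζ⟫_ℂ = 0) {x : L →L[ℂ] L}
    (hx : x ∈ StarSubalgebra.centralizer ℂ (StarSubalgebra.centralizer ℂ E : Set (L →L[ℂ] L))) :
    ⟪θ, amplify ι x ζ⟫_ℂ = 0 := by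
  set N := Submodule.span ℂ E with hN
  set W := (N.map (amplifyVec ζ)).topologicalClosure with hW
  have hNmul : ∀ g ∈ E, ∀ b ∈ N, g * b ∈ N := by
    intro g hg b hb
    induction hb using Submodule.span_induction with
    | mem b hb => exact Submodule.subset_span (hmul g hg b hb)
    | zero => rw [mul_zero]; exact zero_mem _
    | add b c _ _ hb hc => rw [mul_add]; exact add_mem hb hc
    | smul r b _ hb => rw [mul_smul_comm]; exact Submodule.smul_mem _ _ hb
  -- The projection onto `W`, the closure of `(1 ⊗ span E) ζ`, commutes with `1 ⊗ E`, hence with `1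
  -- ⊗ x`. So `(1 ⊗ x) ζ` stays in `W`, to which `θ` is orthogonal.
  have hcomm : Commute (amplify ι x) W.starProjection :=
    commute_amplify_of_mem_centralizer hE hx fun g hg =>
      commute_amplify_starProjection ζ N (hNmul g hg) (hNmul _ (hE g hg))
  have hζ : ζ ∈ W := by
    refine Submodule.le_topologicalClosure _ ⟨1, Submodule.subset_span h1, ?_⟩
    rw [amplifyVec_apply, amplify_one]; rfl
  have hxζ : amplify ι x ζ ∈ W := by
    have h2 := DFunLike.congr_fun hcomm.eq ζ
    rw [mul_apply_eq_comp, mul_apply_eq_comp, Submodule.starProjection_eq_self_iff.2 hζ] at h2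
    rw [h2]
    exact Submodule.starProjection_apply_mem _ _
  have hker : W ≤ LinearMap.ker (innerSL ℂ θ).toLinearMap := by
    refine Submodule.topologicalClosure_minimal _ ?_ (innerSL ℂ θ).isClosed_ker
    rintro _ ⟨b, hb, rfl⟩
    rw [LinearMap.mem_ker]
    induction hb using Submodule.span_induction with
    | mem b hb => exact h0 b hb
    | zero => rw [map_zero, map_zero]
    | add b c _ _ hb hc => rw [map_add, map_add, hb, hc, add_zero]
    | smul r b _ hb => rw [map_smul, map_smul, hb, smul_zero]
  exact LinearMap.mem_ker.1 (hker hxζ)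

end Amplification

/-! ### Dominated forms and their positive operators -/

section RadonNikodym

/-- A positive semidefinite form is realized by vectors in a Hilbert space. -/
theorem exists_hilbert_realization.{u} {V : Type u} [AddCommGroup V] [Module ℂ V]
    (c : PreInnerProductSpace.Core ℂ V) :
    ∃ (G : Type u) (_ : NormedAddCommGroup G) (_ : InnerProductSpace ℂ G) (_ : CompleteSpace G)
      (k : V →ₗ[ℂ] G), ∀ a b, ⟪k a, k b⟫_ℂ = c.inner a b := by
  let _ : SeminormedAddCommGroup V := InnerProductSpace.Core.toSeminormedAddCommGroup (c := c)
  let _ : InnerProductSpace ℂ V := InnerProductSpace.ofCore c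
  exact ⟨UniformSpace.Completion V, inferInstance, inferInstance, inferInstance,
    (UniformSpace.Completion.toComplL (𝕜 := ℂ) (E := V)).toLinearMap,
    fun a b => UniformSpace.Completion.inner_coe a b⟩

variable {H : Type*} [NormedAddCommGroup H] [InnerProductSpace ℂ H] [CompleteSpace H]

/-- A bounded linear map defined on the range of `j` extends by zero on the orthogonal
complement. -/
theorem exists_extension_of_norm_le {V G : Type*} [AddCommGroup V] [Module ℂ V]
    [NormedAddCommGroup G] [NormedSpace ℂ G] [CompleteSpace G] (j : V →ₗ[ℂ] H) (k : V →ₗ[ℂ] G)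
    {C : ℝ} (h : ∀ a, ‖k a‖ ≤ C * ‖j a‖) :
    ∃ F : H →L[ℂ] G, (∀ a, F (j a) = k a) ∧
      F ∘L (LinearMap.range j).topologicalClosure.starProjection = F := by
  set W := (LinearMap.range j).topologicalClosure with hW
  have hjW : ∀ a, j a ∈ W := fun a => Submodule.le_topologicalClosure _ ⟨a, rfl⟩
  set e : V →ₗ[ℂ] W := j.codRestrict W hjW with he
  have hdense : DenseRange e := by
    intro x
    rw [closure_subtype]
    have h1 : Subtype.val '' Set.range e = (LinearMap.range j : Set H) := by
      rw [← Set.range_comp]; rfl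
    rw [h1]
    exact x.2
  have hb : ∃ C, ∀ a, ‖k a‖ ≤ C * ‖e a‖ := ⟨C, h⟩
  refine ⟨k.extendOfNorm e ∘L W.orthogonalProjectionOnto, fun a => ?_, ?_⟩
  · rw [ContinuousLinearMap.comp_apply]
    have h2 : W.orthogonalProjectionOnto (j a) = e a := by
      refine Subtype.ext ?_
      exact Submodule.starProjection_eq_self_iff.2 (hjW a)
    rw [h2, LinearMap.extendOfNorm_eq hdense hb]
  · refine ContinuousLinearMap.ext fun x => ?_
    rw [ContinuousLinearMap.comp_apply, ContinuousLinearMap.comp_apply,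
      ContinuousLinearMap.comp_apply]
    congr 1
    refine Subtype.ext ?_
    exact Submodule.starProjection_eq_self_iff.2 (Submodule.starProjection_apply_mem W x)

/-- A form dominated by `C * ⟪j ·, j ·⟫` is given by a positive operator on the closure of the
range of `j`. -/
theorem exists_positive_operator_of_dominated {V : Type*} [AddCommGroup V] [Module ℂ V]
    (c : PreInnerProductSpace.Core ℂ V) (j : V →ₗ[ℂ] H) {C : ℝ} (hC : 0 ≤ C)
    (h : ∀ a, (c.inner a a).re ≤ C * ‖j a‖ ^ 2) :
    ∃ S : H →L[ℂ] H, 0 ≤ S ∧ (∀ a b, ⟪j a, S (j b)⟫_ℂ = c.inner a b) ∧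
      S * (LinearMap.range j).topologicalClosure.starProjection = S ∧
      (LinearMap.range j).topologicalClosure.starProjection * S = S := by
  obtain ⟨G, _, _, _, k, hk⟩ := exists_hilbert_realization c
  -- Domination makes `j a ↦ k a` well defined and bounded. Its extension `F` yields `S = F⋆ F`,
  -- which pulls the inner product of `G` back to `H`.
  have hb : ∀ a, ‖k a‖ ≤ √C * ‖j a‖ := by
    intro a
    refine (sq_le_sq₀ (norm_nonneg _) (by positivity)).1 ?_
    rw [mul_pow, Real.sq_sqrt hC, ← inner_self_eq_norm_sq (𝕜 := ℂ), hk]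
    exact h a
  obtain ⟨F, hF, hFP⟩ := exists_extension_of_norm_le j k hb
  have hS1 : (ContinuousLinearMap.adjoint F ∘L F) *
      (LinearMap.range j).topologicalClosure.starProjection =
      ContinuousLinearMap.adjoint F ∘L F := by
    rw [ContinuousLinearMap.mul_def, ContinuousLinearMap.comp_assoc, hFP]
  have hpos : 0 ≤ ContinuousLinearMap.adjoint F ∘L F :=
    (ContinuousLinearMap.nonneg_iff_isPositive _).2
      (ContinuousLinearMap.isPositive_adjoint_comp_self F)
  refine ⟨ContinuousLinearMap.adjoint F ∘L F, hpos, fun a b => ?_, hS1, ?_⟩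
  · rw [ContinuousLinearMap.comp_apply, ContinuousLinearMap.adjoint_inner_right, hF, hF, hk]
  · have h1 := congrArg star hS1
    rw [star_mul, (IsSelfAdjoint.of_nonneg hpos).star_eq,
      (isSelfAdjoint_starProjection _).star_eq] at h1
    exact h1

/-- A positive operator has a self-adjoint square root in its bicommutant. -/
theorem exists_sqrt_of_nonneg {S : H →L[ℂ] H} (hS : 0 ≤ S) :
    ∃ R : H →L[ℂ] H, ContinuousLinearMap.adjoint R = R ∧ R * R = S ∧
      ∀ a, Commute a S → Commute R a := by
  refine ⟨cfc Real.sqrt S, IsSelfAdjoint.cfc, ?_, fun a ha => ha.symm.cfc_real Real.sqrt⟩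
  rw [← cfc_mul Real.sqrt Real.sqrt S]
  conv_rhs => rw [← cfc_id ℝ S (IsSelfAdjoint.of_nonneg hS)]
  exact cfc_congr fun t ht => Real.mul_self_sqrt (spectrum_nonneg_of_nonneg hS ht)

end RadonNikodym

/-! ### States dominated by a normal state -/

section Normal

variable {L ι : Type*} [NormedAddCommGroup L] [InnerProductSpace ℂ L] [CompleteSpace L]
  {T : StarSubalgebra ℂ (L →L[ℂ] L)}

/-- A density matrix `∑ |ξₙ⟩⟨ξₙ|` is a single vector of `ℓ² ⊗ L`, and a normal state is a vector
state of the amplification. -/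
theorem State.isNormal_iff {φ : State T} : φ.IsNormal ↔
    ∃ ξ : SquareSummable ℕ L, ∀ a : T, φ.toLinearMap a = ⟪ξ, amplify ℕ (a : L →L[ℂ] L) ξ⟫_ℂ := by
  constructor
  · rintro ⟨ξ, hξ, h⟩
    exact ⟨⟨ξ, memlp_two_iff.2 hξ⟩, fun a => (h a).unique (hasSum_inner_amplify _ _ _)⟩
  · rintro ⟨ξ, h⟩
    exact ⟨ξ, ξ.hasSum_norm_sq.summable, fun a => h a ▸ hasSum_inner_amplify ξ ξ _⟩

/-- The operators `1 ⊗ a` commute with the operator of a form `φ (a⋆ b)`. -/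
theorem commute_amplify_of_inner_eq (φ : T →ₗ[ℂ] ℂ) {ξ : SquareSummable ι L}
    {S : SquareSummable ι L →L[ℂ] SquareSummable ι L} (j : T →ₗ[ℂ] SquareSummable ι L)
    (hj : ∀ a : T, j a = amplifyVec ξ a)
    (h : ∀ a b : T, ⟪j a, S (j b)⟫_ℂ = φ (star a * b))
    (h1 : S * (LinearMap.range j).topologicalClosure.starProjection = S)
    (h2 : (LinearMap.range j).topologicalClosure.starProjection * S = S) (a : T) :
    Commute (amplify ι (a : L →L[ℂ] L)) S := by
  set W := (LinearMap.range j).topologicalClosure with hW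
  have hjm : ∀ a b : T, amplify ι (a : L →L[ℂ] L) (j b) = j (a * b) := fun a b => by
    rw [hj, hj, amplify_amplifyVec]; rfl
  have key : ∀ a : T, ∀ w ∈ W, amplify ι (a : L →L[ℂ] L) w ∈ W := by
    intro a w hw
    refine map_mem_closure (amplify ι (a : L →L[ℂ] L)).continuous hw ?_
    rintro _ ⟨b, rfl⟩
    exact ⟨a * b, (hjm a b).symm⟩
  have hP : Commute (amplify ι (a : L →L[ℂ] L)) W.starProjection := by
    refine commute_starProjection (key a) ?_
    rw [adjoint_amplify]
    exact key (star a)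
  -- The commutator vanishes off `W` by `hDP`. On the range of `j` its values lie in `W` by `hPD`,
  -- and they are orthogonal to `W` because both terms have matrix elements `φ (c⋆ a b)`.
  set D := amplify ι (a : L →L[ℂ] L) * S - S * amplify ι (a : L →L[ℂ] L) with hD
  have hDP : D * W.starProjection = D := by
    rw [hD, sub_mul, mul_assoc, h1, mul_assoc, hP.eq, ← mul_assoc, h1]
  have hPD : W.starProjection * D = D := by
    rw [hD, mul_sub, ← mul_assoc, ← hP.eq, mul_assoc, h2, ← mul_assoc, h2]
  have hDj : ∀ b, D (j b) = 0 := by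
    intro b
    have h3 : D (j b) ∈ (LinearMap.range j)ᗮ := by
      rintro _ ⟨c, rfl⟩
      rw [hD, _root_.sub_apply, inner_sub_right, mul_apply_eq_comp, mul_apply_eq_comp, hjm, h,
        ← ContinuousLinearMap.adjoint_inner_left, adjoint_amplify]
      have h4 : amplify ι (star (a : L →L[ℂ] L)) (j c) = j (star a * c) := hjm (star a) c
      rw [h4, h, star_mul, star_star, mul_assoc, sub_self]
    have h4 : D (j b) ∈ Wᗮ := by rwa [hW, Submodule.orthogonal_closure]
    have h5 : D (j b) ∈ W := by
      rw [← hPD]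
      exact Submodule.starProjection_apply_mem W _
    exact inner_self_eq_zero.1 (h4 _ h5)
  have hDW : W ≤ LinearMap.ker D.toLinearMap := by
    refine Submodule.topologicalClosure_minimal _ ?_ D.isClosed_ker
    rintro _ ⟨b, rfl⟩
    exact hDj b
  have hD0 : D = 0 := by
    refine ContinuousLinearMap.ext fun x => ?_
    rw [← hDP, mul_apply_eq_comp]
    exact hDW (Submodule.starProjection_apply_mem W x)
  exact sub_eq_zero.1 hD0

/-- A state dominated by a multiple of a normal state is normal. -/
theorem State.IsNormal.of_dominated {ω φ : State T} (hω : ω.IsNormal) {C : ℝ} (hC : 0 ≤ C)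
    (h : ∀ a : T, (φ.toLinearMap (star a * a)).re ≤ C * (ω.toLinearMap (star a * a)).re) :
    φ.IsNormal := by
  rw [State.isNormal_iff] at hω ⊢
  obtain ⟨ξ, hξ⟩ := hω
  set j : T →ₗ[ℂ] SquareSummable ℕ L := (amplifyVec ξ) ∘ₗ T.subtype.toAlgHom.toLinearMap with hj
  have hja : ∀ a : T, j a = amplifyVec ξ a := fun a => rfl
  have hnorm : ∀ a : T, (ω.toLinearMap (star a * a)).re = ‖j a‖ ^ 2 := fun a => by
    rw [hξ, ← inner_self_eq_norm_sq (𝕜 := ℂ), hja, ← inner_amplify_star_mul]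
    rfl
  obtain ⟨S, hS0, hS, hS1, hS2⟩ := exists_positive_operator_of_dominated φ.preInnerCore j hC
    fun a => (hnorm a) ▸ h a
  have hcomm := commute_amplify_of_inner_eq φ.toLinearMap j hja hS hS1 hS2
  obtain ⟨R, h2, hRR, hRcomm⟩ := exists_sqrt_of_nonneg hS0
  -- With `S = R²` and `R` commuting with `1 ⊗ a`, the vector state of `R ξ` at `a` is `⟪ξ, (1 ⊗ a)
  -- S ξ⟫ = ⟪j (star a), S (j 1)⟫ = φ a`.
  refine ⟨R ξ, fun a => ?_⟩
  have hRa : Commute R (amplify ℕ (a : L →L[ℂ] L)) := hRcomm _ (hcomm a)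
  have h1 : ⟪R ξ, amplify ℕ (a : L →L[ℂ] L) (R ξ)⟫_ℂ =
      ⟪ξ, amplify ℕ (a : L →L[ℂ] L) (S ξ)⟫_ℂ := by
    rw [← hRR, mul_apply_eq_comp, ← ContinuousLinearMap.adjoint_inner_right, h2]
    have h3 := DFunLike.congr_fun hRa.eq (R ξ)
    rw [mul_apply_eq_comp, mul_apply_eq_comp] at h3
    rw [h3]
  have h4 : ξ = j 1 := by
    rw [hja]
    change ξ = amplify ℕ 1 ξ
    rw [amplify_one]
    rfl
  have h5 : amplify ℕ (star (a : L →L[ℂ] L)) ξ = j (star a) := rfl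
  rw [h1, ← ContinuousLinearMap.adjoint_inner_left, adjoint_amplify, h5]
  conv_rhs => rw [h4]
  rw [hS]
  change φ.toLinearMap a = φ.toLinearMap (star (star a) * 1)
  rw [star_star, mul_one]

/-- The states in a finite convex decomposition of a normal state are normal. -/
theorem State.IsNormal.of_decomposition {κ : Type*} {ω : State T} (hω : ω.IsNormal) {s : Finset κ}
    {p : κ → ℝ} {φ : κ → State T} (hp : ∀ i ∈ s, 0 < p i)
    (h : ∀ a, ω.toLinearMap a = ∑ i ∈ s, (p i : ℂ) * (φ i).toLinearMap a) {i : κ} (hi : i ∈ s) :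
    (φ i).IsNormal := by
  -- The other terms of the decomposition are nonnegative on `star a * a`, so `φ i ≤ (p i)⁻¹ ω`
  -- there.
  refine hω.of_dominated (inv_nonneg.2 (hp i hi).le) fun a => ?_
  rw [le_inv_mul_iff₀ (hp i hi), h, Complex.re_sum]
  have hterm : ∀ k, ((p k : ℂ) * (φ k).toLinearMap (star a * a)).re =
      p k * ((φ k).toLinearMap (star a * a)).re := fun k => Complex.re_ofReal_mul _ _
  simp_rw [hterm]
  exact Finset.single_le_sum (f := fun k => p k * ((φ k).toLinearMap (star a * a)).re)
    (fun k hk => mul_nonneg (hp k hk).le (Complex.le_def.1 ((φ k).nonneg_star_mul_self a)).1) hi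

end Normal

/-! ### Normal functionals and normal product states -/

section NormalFunctionals

variable {L : Type*} [NormedAddCommGroup L] [InnerProductSpace ℂ L]

/-- The space of normal functionals `a ↦ ⟪θ, (1 ⊗ a) ζ⟫`. -/
def normalFunctionals (T : Submodule ℂ (L →L[ℂ] L)) : Submodule ℂ (T →ₗ[ℂ] ℂ) where
  carrier := {f | ∃ (ι : Type) (θ ζ : SquareSummable ι L), ∀ a : T, f a = ⟪θ, amplify ι a ζ⟫_ℂ}
  add_mem' := by
    rintro f g ⟨ι, θ, ζ, hf⟩ ⟨κ, θ', ζ', hg⟩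
    have hm : ∀ (x : SquareSummable ι L) (y : SquareSummable κ L), Memℓp (Sum.elim x y) 2 :=
      fun x y => memlp_two_iff.2 (Summable.sum _ x.hasSum_norm_sq.summable
        y.hasSum_norm_sq.summable)
    -- Leaving the index type free lets a sum of functionals be realized on the disjoint union of
    -- the index sets.
    refine ⟨ι ⊕ κ, ⟨_, hm θ θ'⟩, ⟨_, hm ζ ζ'⟩, fun a => ?_⟩
    rw [LinearMap.add_apply, hf, hg]
    exact (HasSum.sum (f := fun i => ⟪Sum.elim θ θ' i, (a : L →L[ℂ] L) (Sum.elim ζ ζ' i)⟫_ℂ)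
      (hasSum_inner_amplify θ ζ a) (hasSum_inner_amplify θ' ζ' a)).unique
      (hasSum_inner_amplify (⟨_, hm θ θ'⟩ : SquareSummable (ι ⊕ κ) L) ⟨_, hm ζ ζ'⟩ a)
  zero_mem' := ⟨PUnit, 0, 0, fun a => by rw [inner_zero_left]; rfl⟩
  smul_mem' := by
    rintro c f ⟨ι, θ, ζ, hf⟩
    exact ⟨ι, θ, c • ζ, fun a => by
      rw [LinearMap.smul_apply, hf, map_smul, inner_smul_right, smul_eq_mul]⟩

variable [CompleteSpace L]

theorem State.IsNormal.mem_normalFunctionals {T : StarSubalgebra ℂ (L →L[ℂ] L)} {φ : State T}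
    (hφ : φ.IsNormal) : φ.toLinearMap ∈ normalFunctionals T.toSubalgebra.toSubmodule := by
  obtain ⟨ξ, h⟩ := State.isNormal_iff.1 hφ
  exact ⟨ℕ, ξ, ξ, h⟩

end NormalFunctionals

section NormalProduct

variable {H K : Type*} [NormedAddCommGroup H] [InnerProductSpace ℂ H] [CompleteSpace H]
  [NormedAddCommGroup K] [InnerProductSpace ℂ K] [CompleteSpace K]
  {A : StarSubalgebra ℂ (H →L[ℂ] H)} {B : StarSubalgebra ℂ (K →L[ℂ] K)}

/-- Normal functionals on a von Neumann algebra tensor product are determined by their values on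
elementary tensors. -/
theorem vonNeumannTensor_functional_ext {f g : vonNeumannTensor A B →ₗ[ℂ] ℂ}
    (hf : f ∈ normalFunctionals (vonNeumannTensor A B).toSubalgebra.toSubmodule)
    (hg : g ∈ normalFunctionals (vonNeumannTensor A B).toSubalgebra.toSubmodule)
    (h : ∀ a b, f (tmulIn (elementaryTensors_subset_vonNeumannTensor A B) a b) =
      g (tmulIn (elementaryTensors_subset_vonNeumannTensor A B) a b)) : f = g := by
  -- The difference is again of the form `⟪θ, (1 ⊗ ·) ζ⟫`, and it vanishes on the elementary
  -- tensors, so the density theorem applies.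
  obtain ⟨ι, θ, ζ, hd⟩ := Submodule.sub_mem _ hf hg
  refine sub_eq_zero.1 (LinearMap.ext fun x => ?_)
  refine (hd x).trans (inner_amplify_eq_zero_of_mem_centralizer one_mem_elementaryTensors
    (fun _ hg _ hh => mul_mem_elementaryTensors hg hh) (fun _ hg => star_mem_elementaryTensors hg)
    ?_ x.2)
  rintro _ ⟨a, ha, b, hb, rfl⟩
  have h1 := hd (tmulIn (elementaryTensors_subset_vonNeumannTensor A B) ⟨a, ha⟩ ⟨b, hb⟩)
  have h2 := h ⟨a, ha⟩ ⟨b, hb⟩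
  exact h1.symm.trans (sub_eq_zero.2 h2)

/-- Products of two sequences are indexed by `ℕ × ℕ`, while normality asks for `ℕ`; the pairing
bijection reindexes. -/
theorem exists_squareSummable_of_prod {L : Type*} [NormedAddCommGroup L] [InnerProductSpace ℂ L]
    {v : ℕ × ℕ → L} (hv : Summable fun n => ‖v n‖ ^ 2) :
    ∃ ζ : SquareSummable ℕ L, ∀ (x : L →L[ℂ] L) (s : ℂ),
      HasSum (fun n => ⟪v n, x (v n)⟫_ℂ) s → ⟪ζ, amplify ℕ x ζ⟫_ℂ = s := by
  have hm : Memℓp (fun n => v (Nat.pairEquiv.symm n)) 2 :=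
    memlp_two_iff.2 ((Nat.pairEquiv.symm.summable_iff (f := fun n => ‖v n‖ ^ 2)).2 hv)
  exact ⟨⟨_, hm⟩, fun x s hs => (hasSum_inner_amplify (⟨_, hm⟩ : SquareSummable ℕ L) ⟨_, hm⟩
    x).unique ((Nat.pairEquiv.symm.hasSum_iff (f := fun n => ⟪v n, x (v n)⟫_ℂ)).2 hs)⟩

theorem hasSum_mul_complex {F G : ℕ → ℂ} {s t : ℂ} (hF : HasSum F s) (hG : HasSum G t)
    {P : ℕ × ℕ → ℂ} (hP : ∀ n, F n.1 * G n.2 = P n) : HasSum P (s * t) :=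
  (funext hP : (fun n : ℕ × ℕ => F n.1 * G n.2) = P) ▸
    hF.mul hG (summable_mul_of_summable_norm hF.summable.norm hG.summable.norm)

/-- The tensor product of square summable families. -/
theorem exists_tmul_squareSummable (ξ : SquareSummable ℕ H) (η : SquareSummable ℕ K) :
    ∃ ζ : SquareSummable ℕ (HilbertTensor H K), ∀ (a : H →L[ℂ] H) (b : K →L[ℂ] K),
      ⟪ζ, amplify ℕ (opTensor a b) ζ⟫_ℂ = ⟪ξ, amplify ℕ a ξ⟫_ℂ * ⟪η, amplify ℕ b η⟫_ℂ := by
  have hm : Summable fun n : ℕ × ℕ =>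
      ‖(tmulLeft (ξ n.1) (η n.2) : HilbertTensor H K)‖ ^ 2 := by
    have h1 : Summable fun n : ℕ × ℕ => ‖ξ n.1‖ ^ 2 * ‖η n.2‖ ^ 2 :=
      ξ.hasSum_norm_sq.summable.mul_of_nonneg η.hasSum_norm_sq.summable
        (fun _ => sq_nonneg _) (fun _ => sq_nonneg _)
    refine h1.congr fun n => ?_
    rw [norm_tmulLeft_apply, mul_pow]
  obtain ⟨ζ, hζ⟩ := exists_squareSummable_of_prod hm
  refine ⟨ζ, fun a b => hζ _ _ ?_⟩
  have h3 : ∀ n : ℕ × ℕ, ⟪ξ n.1, a (ξ n.1)⟫_ℂ * ⟪η n.2, b (η n.2)⟫_ℂ =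
      ⟪(tmulLeft (ξ n.1) (η n.2) : HilbertTensor H K),
        opTensor a b (tmulLeft (ξ n.1) (η n.2))⟫_ℂ := fun n => by
    rw [opTensor_tmulLeft, inner_tmulLeft]
  exact hasSum_mul_complex (hasSum_inner_amplify ξ ξ a) (hasSum_inner_amplify η η b) h3

/-- Normal states have normal product states. -/
theorem exists_normal_productState
    {T : StarSubalgebra ℂ (HilbertTensor H K →L[ℂ] HilbertTensor H K)}
    (hT : elementaryTensors A B ⊆ (T : Set _)) {φ : State A} {ψ : State B} (hφ : φ.IsNormal)
    (hψ : ψ.IsNormal) : ∃ Φ : State T, Φ.IsNormal ∧ IsProductState hT φ ψ Φ := by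
  obtain ⟨ξ, hξ⟩ := State.isNormal_iff.1 hφ
  obtain ⟨η, hη⟩ := State.isNormal_iff.1 hψ
  obtain ⟨ζ, hζ⟩ := exists_tmul_squareSummable ξ η
  set f : T →ₗ[ℂ] ℂ := (innerSL ℂ ζ).toLinearMap ∘ₗ amplifyVec ζ ∘ₗ T.subtype.toAlgHom.toLinearMap
    with hf
  have hfa : ∀ x : T, f x = ⟪ζ, amplify ℕ (x : HilbertTensor H K →L[ℂ] HilbertTensor H K) ζ⟫_ℂ :=
    fun x => rfl
  have hprod : ∀ a b, f (tmulIn hT a b) = φ.toLinearMap a * ψ.toLinearMap b := fun a b => by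
    rw [hξ, hη, ← hζ]
    rfl
  have h1 : f 1 = 1 := by
    rw [← tmulIn_one hT, hprod, φ.map_one, ψ.map_one, mul_one]
  have hpos : ∀ x, 0 ≤ f (star x * x) := fun x => by
    rw [hfa]
    have h2 := inner_amplify_star_mul ζ (x : HilbertTensor H K →L[ℂ] HilbertTensor H K)
      (x : HilbertTensor H K →L[ℂ] HilbertTensor H K)
    exact (zero_le_inner_self _).trans_eq h2.symm
  have hc : Continuous f := by
    refine AddMonoidHomClass.continuous_of_bound f (‖ζ‖ * ‖ζ‖) fun x => ?_
    rw [hfa]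
    calc ‖⟪ζ, amplify ℕ (x : HilbertTensor H K →L[ℂ] HilbertTensor H K) ζ⟫_ℂ‖
        ≤ ‖ζ‖ * (‖x‖ * ‖ζ‖) := (norm_inner_le_norm _ _).trans (mul_le_mul_of_nonneg_left
          ((amplify ℕ (x : HilbertTensor H K →L[ℂ] HilbertTensor H K)).le_of_opNorm_le
            (norm_amplify_le _) ζ) (norm_nonneg _))
      _ = ‖ζ‖ * ‖ζ‖ * ‖x‖ := by ring
  exact ⟨State.ofLinearMap f h1 hpos hc, State.isNormal_iff.2 ⟨ζ, hfa⟩, hprod⟩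

end NormalProduct

/-! ### Uniqueness of product states and sums of them -/

section ProductStates

variable {H K : Type*} [NormedAddCommGroup H] [InnerProductSpace ℂ H] [CompleteSpace H]
  [NormedAddCommGroup K] [InnerProductSpace ℂ K] [CompleteSpace K]
  {A : StarSubalgebra ℂ (H →L[ℂ] H)} {B : StarSubalgebra ℂ (K →L[ℂ] K)}

/-- The sum of product states has the same values on elementary tensors as the product state. -/
theorem IsProductState.sum_apply_tmulIn
    {T : StarSubalgebra ℂ (HilbertTensor H K →L[ℂ] HilbertTensor H K)}
    {hT : elementaryTensors A B ⊆ (T : Set _)} {ω₁ : State A} {ω₂ : State B} {Ω : State T}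
    (hΩ : IsProductState hT ω₁ ω₂ Ω) {s : Finset ℕ} {p : ℕ → ℝ} {φ : ℕ → State A}
    {ψ : ℕ → State B} (h₁ : ∀ a, ω₁.toLinearMap a = ∑ i ∈ s, (p i : ℂ) * (φ i).toLinearMap a)
    (h₂ : ∀ b, ω₂.toLinearMap b = ∑ j ∈ s, (p j : ℂ) * (ψ j).toLinearMap b)
    {Φ : ℕ → ℕ → State T} (hΦ : ∀ i ∈ s, ∀ j ∈ s, IsProductState hT (φ i) (ψ j) (Φ i j))
    (a : A) (b : B) : Ω.toLinearMap (tmulIn hT a b) =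
      (∑ i ∈ s, ∑ j ∈ s, ((p i : ℂ) * p j) • (Φ i j).toLinearMap) (tmulIn hT a b) := by
  rw [hΩ, h₁, h₂, Finset.sum_mul_sum, LinearMap.sum_apply]
  refine Finset.sum_congr rfl fun i hi => ?_
  rw [LinearMap.sum_apply]
  refine Finset.sum_congr rfl fun j hj => ?_
  rw [LinearMap.smul_apply, hΦ i hi j hj a b, smul_eq_mul]
  ring

theorem cstarTensor_productState_unique {φ : State A} {ψ : State B}
    {Φ Ψ : State (cstarTensor A B)}
    (hΦ : IsProductState (elementaryTensors_subset_cstarTensor A B) φ ψ Φ)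
    (hΨ : IsProductState (elementaryTensors_subset_cstarTensor A B) φ ψ Ψ) : Φ = Ψ :=
  State.ext fun x => LinearMap.congr_fun (cstarTensor_functional_ext Φ.continuous_toLinearMap
    Ψ.continuous_toLinearMap fun a b => (hΦ a b).trans (hΨ a b).symm) x

theorem vonNeumannTensor_productState_unique {φ : State A} {ψ : State B}
    {Φ Ψ : State (vonNeumannTensor A B)} (hΦn : Φ.IsNormal) (hΨn : Ψ.IsNormal)
    (hΦ : IsProductState (elementaryTensors_subset_vonNeumannTensor A B) φ ψ Φ)
    (hΨ : IsProductState (elementaryTensors_subset_vonNeumannTensor A B) φ ψ Ψ) : Φ = Ψ :=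
  State.ext fun x => LinearMap.congr_fun (vonNeumannTensor_functional_ext
    hΦn.mem_normalFunctionals hΨn.mem_normalFunctionals
    fun a b => (hΦ a b).trans (hΨ a b).symm) x

end ProductStates

/-! ### The inequality for the two tensor products -/

section Doubling

variable {H₁ H₂ : Type*} [NormedAddCommGroup H₁] [InnerProductSpace ℂ H₁] [CompleteSpace H₁]
  [FiniteDimensional ℂ H₁] [NormedAddCommGroup H₂] [InnerProductSpace ℂ H₂] [CompleteSpace H₂]
  {M : StarSubalgebra ℂ (H₂ →L[ℂ] H₂)}
  {A : StarSubalgebra ℂ (HilbertTensor H₁ H₂ →L[ℂ] HilbertTensor H₁ H₂)}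
  {T : StarSubalgebra ℂ (HilbertTensor (HilbertTensor H₁ H₂) (HilbertTensor H₁ H₂) →L[ℂ]
    HilbertTensor (HilbertTensor H₁ H₂) (HilbertTensor H₁ H₂))}

/-- Subadditivity of the entanglement of formation, if the states in a decomposition of `ω` have
product states from which `Ω` is recovered. -/
theorem entanglementOfFormation_doubled_le
    (hAc : IsClosed (A : Set (HilbertTensor H₁ H₂ →L[ℂ] HilbertTensor H₁ H₂)))
    (hA : elementaryTensors (⊤ : StarSubalgebra ℂ (H₁ →L[ℂ] H₁)) M ⊆ (A : Set _))
    (hT : elementaryTensors A A ⊆ (T : Set _)) {ω : State A} {Ω : State T}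
    (h : ∀ (s : Finset ℕ) (p : ℕ → ℝ) (φ : ℕ → State A), (∀ i ∈ s, 0 < p i) →
      (∀ a, ω.toLinearMap a = ∑ i ∈ s, (p i : ℂ) * (φ i).toLinearMap a) →
      ∃ Φ : ℕ → ℕ → State T, (∀ i ∈ s, ∀ j ∈ s, IsProductState hT (φ i) (φ j) (Φ i j)) ∧
        Ω.toLinearMap = ∑ i ∈ s, ∑ j ∈ s, ((p i : ℂ) * p j) • (Φ i j).toLinearMap) :
    entanglementOfFormation (doubledSubsystem hA hT) Ω ≤
      2 * entanglementOfFormation (subsystem hA) ω := by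
  refine entanglementOfFormation_le_two_mul hAc (isStateFunctional_subsystem hA)
    (isStateFunctional_doubledSubsystem hA hT) fun s p φ hp hω => ?_
  obtain ⟨Φ, hΦ, hΩ⟩ := h s p φ hp hω
  refine ⟨Φ, fun i hi j hj X Y => ?_, fun x => ?_⟩
  · rw [doubledSubsystem_mapL]
    exact hΦ i hi j hj _ _
  · rw [hΩ, LinearMap.sum_apply]
    refine Finset.sum_congr rfl fun i _ => ?_
    rw [LinearMap.sum_apply]
    rfl

theorem entanglementOfFormation_cstarTensor_le
    (hAc : IsClosed (A : Set (HilbertTensor H₁ H₂ →L[ℂ] HilbertTensor H₁ H₂)))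
    (hA : elementaryTensors (⊤ : StarSubalgebra ℂ (H₁ →L[ℂ] H₁)) M ⊆ (A : Set _)) {ω : State A}
    {Ω : State (cstarTensor A A)}
    (hΩ : IsProductState (elementaryTensors_subset_cstarTensor A A) ω ω Ω) :
    entanglementOfFormation (doubledSubsystem hA (elementaryTensors_subset_cstarTensor A A)) Ω ≤
      2 * entanglementOfFormation (subsystem hA) ω := by
  refine entanglementOfFormation_doubled_le hAc hA _ fun s p φ _ hω => ?_
  choose Φ hΦ using fun i j => exists_productState hAc hAc (φ i) (φ j)
  refine ⟨Φ, fun i _ j _ => hΦ i j, ?_⟩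
  refine cstarTensor_functional_ext Ω.continuous_toLinearMap ?_
    (hΩ.sum_apply_tmulIn hω hω fun i _ j _ => hΦ i j)
  have h1 : Continuous fun x => ∑ i ∈ s, ∑ j ∈ s, ((p i : ℂ) * p j) • (Φ i j).toLinearMap x :=
    continuous_finsetSum _ fun i _ => continuous_finsetSum _ fun j _ =>
      continuous_const.mul (Φ i j).continuous_toLinearMap
  exact h1.congr fun x => by simp [LinearMap.sum_apply]

/-- The states of a finite decomposition of `ω` with positive weights are automatically normal, so
they have normal products, and the weighted sum of these is a normal functional that can be compared
with `Ω` on elementary tensors. -/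
theorem entanglementOfFormation_vonNeumannTensor_le
    (hAc : IsClosed (A : Set (HilbertTensor H₁ H₂ →L[ℂ] HilbertTensor H₁ H₂)))
    (hA : elementaryTensors (⊤ : StarSubalgebra ℂ (H₁ →L[ℂ] H₁)) M ⊆ (A : Set _)) {ω : State A}
    (hω : ω.IsNormal) {Ω : State (vonNeumannTensor A A)} (hΩn : Ω.IsNormal)
    (hΩ : IsProductState (elementaryTensors_subset_vonNeumannTensor A A) ω ω Ω) :
    entanglementOfFormation (doubledSubsystem hA (elementaryTensors_subset_vonNeumannTensor A A)) Ω
      ≤ 2 * entanglementOfFormation (subsystem hA) ω := by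
  refine entanglementOfFormation_doubled_le hAc hA _ fun s p φ hp hφ => ?_
  have h1 : ∀ i j, ∃ Φ : State (vonNeumannTensor A A), i ∈ s → j ∈ s → Φ.IsNormal ∧
      IsProductState (elementaryTensors_subset_vonNeumannTensor A A) (φ i) (φ j) Φ := by
    intro i j
    by_cases h : i ∈ s ∧ j ∈ s
    · obtain ⟨Φ, hΦ⟩ := exists_normal_productState
        (elementaryTensors_subset_vonNeumannTensor A A)
        (hω.of_decomposition hp hφ h.1) (hω.of_decomposition hp hφ h.2)
      exact ⟨Φ, fun _ _ => hΦ⟩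
    -- Outside `s` nothing is known about `φ`, and `Ω` serves as a dummy value.
    · exact ⟨Ω, fun hi hj => absurd ⟨hi, hj⟩ h⟩
  choose Φ hΦ using h1
  have hprod := fun i hi j hj => (hΦ i j hi hj).2
  refine ⟨Φ, hprod, ?_⟩
  exact vonNeumannTensor_functional_ext hΩn.mem_normalFunctionals
    (Submodule.sum_mem _ fun i hi => Submodule.sum_mem _ fun j hj =>
      Submodule.smul_mem _ _ (hΦ i j hi hj).1.mem_normalFunctionals)
    (hΩ.sum_apply_tmulIn hφ hφ hprod)

end Doubling

end

theorem mainTheorem7 {H₁ H₂ : Type*}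
    [NormedAddCommGroup H₁] [InnerProductSpace ℂ H₁] [CompleteSpace H₁] [FiniteDimensional ℂ H₁]
    [NormedAddCommGroup H₂] [InnerProductSpace ℂ H₂] [CompleteSpace H₂] :
    -- unital C⋆-algebras `M ⊆ B(H₂)`, spatial C⋆-tensor products, arbitrary states
    (∀ M : StarSubalgebra ℂ (H₂ →L[ℂ] H₂), IsClosed (M : Set (H₂ →L[ℂ] H₂)) →
      let A := cstarTensor (⊤ : StarSubalgebra ℂ (H₁ →L[ℂ] H₁)) M
      let T := cstarTensor A A
      let hA := elementaryTensors_subset_cstarTensor (⊤ : StarSubalgebra ℂ (H₁ →L[ℂ] H₁)) M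
      let hT := elementaryTensors_subset_cstarTensor A A
      ∀ ω : State A,
        (∃! Ω : State T, IsProductState hT ω ω Ω) ∧
        ∀ Ω : State T, IsProductState hT ω ω Ω →
          entanglementOfFormation (doubledSubsystem hA hT) Ω ≤
            2 * entanglementOfFormation (subsystem hA) ω) ∧
    -- von Neumann algebras `M ⊆ B(H₂)`, von Neumann algebra tensor products, normal states
    (∀ M : VonNeumannAlgebra H₂,
      let A := vonNeumannTensor (⊤ : StarSubalgebra ℂ (H₁ →L[ℂ] H₁)) M.toStarSubalgebra
      let T := vonNeumannTensor A A
      let hA := elementaryTensors_subset_vonNeumannTensor (⊤ : StarSubalgebra ℂ (H₁ →L[ℂ] H₁))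
        M.toStarSubalgebra
      let hT := elementaryTensors_subset_vonNeumannTensor A A
      ∀ ω : State A, ω.IsNormal →
        (∃! Ω : State T, Ω.IsNormal ∧ IsProductState hT ω ω Ω) ∧
        ∀ Ω : State T, Ω.IsNormal → IsProductState hT ω ω Ω →
          entanglementOfFormation (doubledSubsystem hA hT) Ω ≤
            2 * entanglementOfFormation (subsystem hA) ω) := by
  refine ⟨fun M _ => ?_, fun M => ?_⟩
  · intro A T hA hT ω
    obtain ⟨Ω, hΩ⟩ := exists_productState isClosed_cstarTensor isClosed_cstarTensor ω ω
    exact ⟨⟨Ω, hΩ, fun Ψ hΨ => cstarTensor_productState_unique hΨ hΩ⟩,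
      fun Ω hΩ => entanglementOfFormation_cstarTensor_le isClosed_cstarTensor hA hΩ⟩
  · intro A T hA hT ω hω
    obtain ⟨Ω, hΩn, hΩ⟩ := exists_normal_productState hT hω hω
    exact ⟨⟨Ω, ⟨hΩn, hΩ⟩, fun Ψ hΨ => vonNeumannTensor_productState_unique hΨ.1 hΩn hΨ.2 hΩ⟩,
      fun Ω hΩn hΩ => entanglementOfFormation_vonNeumannTensor_le isClosed_vonNeumannTensor hA hω
        hΩn hΩ⟩
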